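/- Let $\mathcal H=L^2_{\mathbb C}(\mathbb R_+)$ and let $F(\mathcal H)=\mathbb C\Omega\oplus\bigoplus_{n\ge 1}\mathcal H^{\otimes n}$ (Hilbert space direct sum of completed tensor powers) be the free Fock space. For $h\in\mathcal H$ let $l(h)$ be the left creation operator, i.e. the bounded operator with $l(h)\Omega=h$ and $l(h)(g_1\otimes\cdots\otimes g_n)=h\otimes g_1\otimes\cdots\otimes g_n$, and let $S(h)=l(h)+l(h)^*$. For $t\ge 0$ put $S_t=S(\mathbf 1_{[0,t]})$ (the free Brownian motion). For a set $A$ of bounded operators let $W^*(A)=(A\cup A^*)''$ be the von Neumann algebra generated by $A$; a von Neumann algebra $\mathcal N$ is a factor if its center $\mathcal N\cap\mathcal N'$ equals $\mathbb C1$. (1) $W^*(\{S_t:t\ge 0\})=W^*(\{S(h):h\in L^2_{\mathbb R}(\mathbb R_+)\})=:\mathcal{SC}$, and $\mathcal{SC}$ is a factor. (2) More generally, the von Neumann algebra generated by any free Brownian motion is a factor. That is, let $\mathcal M$ be a von Neumann algebra on a complex Hilbert space with a faithful normal state $\tau$, and let $(S_t)_{t\ge 0}$ be self-adjoint elements of $\mathcal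 M$ forming a centered semicircular process of covariance $\tau(S_sS_t)=s\wedge t$, i.e. for all $n\ge 0$ and $t_1,\dots,t_n\ge 0$, $$\tau(S_{t_1}\cdots S_{t_n})=\sum_{\pi\in NC_2(n)}\ \prod_{\{a,b\}\in\pi} t_a\wedge t_b ,$$ where $NC_2(n)$ is the set of noncrossing pair partitions of $\{1,\dots,n\}$. Then $W^*(\{S_t:t\ge 0\})$ is a factor. -/

import Mathlib

open scoped TensorProduct NNReal ENNReal InnerProductSpace ComplexOrder
open MeasureTheory UniformSpace

universe u

namespace FreeFock

/-! ### Algebraic tensor powers of a complex inner product space -/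

/-- A bundled complex inner product space (only used to run a recursion). -/
structure PreHilb where
  carrier : Type
  [grp : NormedAddCommGroup carrier]
  [ips : InnerProductSpace ℂ carrier]

attribute [instance] PreHilb.grp PreHilb.ips

/-- The recursion `E^{⊗0} = ℂ`, `E^{⊗(n+1)} = E ⊗ E^{⊗n}`; the inner product on each step is
Mathlib's, `⟪x ⊗ y, x' ⊗ y'⟫ = ⟪x, x'⟫ ⟪y, y'⟫`. -/
noncomputable def tensorPowAux (E : Type) [NormedAddCommGroup E] [InnerProductSpace ℂ E] :
    ℕ → PreHilb
  | 0 => ⟨ℂ⟩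
  | n + 1 => ⟨E ⊗[ℂ] (tensorPowAux E n).carrier⟩

/-- The algebraic tensor power `E^{⊗n}`, with inner product
`⟪g₁ ⊗ ⋯ ⊗ gₙ, h₁ ⊗ ⋯ ⊗ hₙ⟫ = ⟪g₁, h₁⟫ ⋯ ⟪gₙ, hₙ⟫`. -/
def TensorPow (E : Type) [NormedAddCommGroup E] [InnerProductSpace ℂ E] (n : ℕ) : Type :=
  (tensorPowAux E n).carrier

variable (E : Type) [NormedAddCommGroup E] [InnerProductSpace ℂ E]

noncomputable instance (n : ℕ) : NormedAddCommGroup (TensorPow E n) :=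
  (tensorPowAux E n).grp

noncomputable instance (n : ℕ) : InnerProductSpace ℂ (TensorPow E n) :=
  (tensorPowAux E n).ips

/-- The full (free) Fock space `ℂΩ ⊕ ⨁_{n ≥ 1} E^{⊗n}`: the Hilbert space direct sum of the
completed tensor powers. -/
abbrev Fock : Type := lp (fun n : ℕ => Completion (TensorPow E n)) 2

/-- The scalar `1`, as an element of `E^{⊗0} = ℂ`. -/
noncomputable def unitTensor : TensorPow E 0 := (1 : ℂ)

/-- The vacuum vector `Ω`. -/
noncomputable def vacuum : Fock E :=
  lp.single 2 0 ((unitTensor E : TensorPow E 0) : Completion (TensorPow E 0))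

variable {E}

/-- `x ↦ h ⊗ x` from `E^{⊗n}` to `E^{⊗(n+1)}`. -/
noncomputable def tensorCons (h : E) (n : ℕ) : TensorPow E n →L[ℂ] TensorPow E (n + 1) :=
  TensorProduct.mkL ℂ E (tensorPowAux E n).carrier h

theorem norm_tensorCons (h : E) (n : ℕ) (x : TensorPow E n) :
    ‖tensorCons h n x‖ = ‖h‖ * ‖x‖ :=
  TensorProduct.norm_tmul (𝕜 := ℂ) (F := (tensorPowAux E n).carrier) h x

theorem norm_completion_tensorCons_le (h : E) (n : ℕ) (x : Completion (TensorPow E n)) :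
    ‖(tensorCons h n).completion x‖ ≤ ‖h‖ * ‖x‖ := by
  induction x using Completion.induction_on with
  | hp =>
    exact isClosed_le ((tensorCons h n).completion.continuous.norm)
      (continuous_const.mul continuous_norm)
  | ih x =>
    rw [ContinuousLinearMap.completion_apply_coe, Completion.norm_coe, Completion.norm_coe,
      norm_tensorCons]

/-- The components of `l(h) f`: the component of degree `0` vanishes, the one of degree `n + 1` is
`h ⊗ fₙ`. -/
noncomputable def creationFun (h : E) (f : ∀ n, Completion (TensorPow E n)) :
    ∀ n, Completion (TensorPow E n)
  | 0 => 0
  | n + 1 => (tensorCons h n).completion (f n)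

theorem summable_creationFun (h : E) (f : Fock E) :
    Summable fun n => ‖creationFun h f n‖ ^ 2 := by
  have hf : Summable fun n => ‖f n‖ ^ 2 := by
    have := (lp.memℓp f).summable (by norm_num)
    simpa using this
  rw [← summable_nat_add_iff 1]
  refine Summable.of_nonneg_of_le (fun n => by positivity) (fun n => ?_) (hf.mul_left (‖h‖ ^ 2))
  rw [← mul_pow]
  exact pow_le_pow_left₀ (norm_nonneg _) (norm_completion_tensorCons_le h n (f n)) 2

theorem norm_sq_eq_tsum (f : Fock E) : ‖f‖ ^ 2 = ∑' n, ‖f n‖ ^ 2 := by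
  have := lp.norm_rpow_eq_tsum (p := 2) (by norm_num) f
  simpa using this

/-- The vector `l(h) f` of the Fock space. -/
noncomputable def creationVec (h : E) (f : Fock E) : Fock E :=
  ⟨creationFun h f, memℓp_gen (by simpa using summable_creationFun h f)⟩

theorem norm_creationVec_le (h : E) (f : Fock E) : ‖creationVec h f‖ ≤ ‖h‖ * ‖f‖ := by
  refine (sq_le_sq₀ (norm_nonneg _) (by positivity)).1 ?_
  have hf : Summable fun n => ‖f n‖ ^ 2 := by
    have := (lp.memℓp f).summable (by norm_num)
    simpa using this
  have h1 : ‖creationVec h f‖ ^ 2 = ∑' n, ‖creationFun h f n‖ ^ 2 :=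
    norm_sq_eq_tsum (creationVec h f)
  rw [h1, mul_pow, norm_sq_eq_tsum f, ← tsum_mul_left,
    (summable_creationFun h f).tsum_eq_zero_add]
  have h0 : ‖creationFun h f 0‖ ^ 2 = 0 := by simp [creationFun]
  refine (add_le_of_nonpos_left h0.le).trans ?_
  refine Summable.tsum_le_tsum (fun n => ?_)
    ((summable_nat_add_iff 1).2 (summable_creationFun h f)) (hf.mul_left _)
  rw [← mul_pow]
  exact pow_le_pow_left₀ (norm_nonneg _) (norm_completion_tensorCons_le h n (f n)) 2

/-- The left creation operator `l(h)`, a bounded operator on the Fock space determined by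
`l(h) Ω = h` and `l(h) (g₁ ⊗ ⋯ ⊗ gₙ) = h ⊗ g₁ ⊗ ⋯ ⊗ gₙ`. -/
noncomputable def leftCreation (h : E) : Fock E →L[ℂ] Fock E :=
  LinearMap.mkContinuous
    { toFun := creationVec h
      map_add' := fun f g => by
        ext n
        cases n with
        | zero => exact (add_zero (0 : Completion (TensorPow E 0))).symm
        | succ n => exact map_add (tensorCons h n).completion (f n) (g n)
      map_smul' := fun c f => by
        ext n
        cases n with
        | zero => exact (smul_zero (A := Completion (TensorPow E 0)) c).symm
        | succ n => exact map_smul (tensorCons h n).completion c (f n) }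
    ‖h‖ (norm_creationVec_le h)

/-- The left annihilation operator `l*(h)`, the adjoint of `l(h)`. -/
noncomputable def leftAnnihilation (h : E) : Fock E →L[ℂ] Fock E :=
  ContinuousLinearMap.adjoint (leftCreation h)

/-- The semicircular operator `S(h) = l(h) + l*(h)`. -/
noncomputable def semicircular (h : E) : Fock E →L[ℂ] Fock E :=
  leftCreation h + leftAnnihilation h

end FreeFock

/-! ### von Neumann algebras -/

/-- The von Neumann algebra `W*(s)` generated by a set `s` of bounded operators: the double
commutant of `s ∪ s*`. -/
noncomputable def generatedVN {H : Type u} [NormedAddCommGroup H] [InnerProductSpace ℂ H]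
    [CompleteSpace H] (s : Set (H →L[ℂ] H)) : VonNeumannAlgebra H where
  toStarSubalgebra :=
    StarSubalgebra.centralizer ℂ (StarSubalgebra.centralizer ℂ s : Set (H →L[ℂ] H))
  centralizer_centralizer' := by simp

/-- A von Neumann algebra `M` is a factor if its center `M ∩ M'` is `ℂ 1`. -/
def IsFactor {H : Type u} [NormedAddCommGroup H] [InnerProductSpace ℂ H]
    [CompleteSpace H] (M : VonNeumannAlgebra H) : Prop :=
  (M : Set (H →L[ℂ] H)) ∩ (M.commutant : Set (H →L[ℂ] H)) =
    Set.range (algebraMap ℂ (H →L[ℂ] H))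

/-- `τ` is a faithful normal state on the von Neumann algebra `M`. Normality is continuity for the
ultraweak (σ-weak) topology: `τ` is of the form `x ↦ ∑ₙ ⟪ηₙ, x ξₙ⟫` with `ξ, η` square summable. -/
structure IsFaithfulNormalState {H : Type u} [NormedAddCommGroup H] [InnerProductSpace ℂ H]
    [CompleteSpace H] (M : VonNeumannAlgebra H) (τ : M.toStarSubalgebra →ₗ[ℂ] ℂ) : Prop where
  map_one : τ 1 = 1
  nonneg : ∀ x, 0 ≤ τ (star x * x)
  faithful : ∀ x, τ (star x * x) = 0 → x = 0
  normal : ∃ ξ η : ℕ → H, (Summable fun n => ‖ξ n‖ ^ 2) ∧ (Summable fun n => ‖η n‖ ^ 2) ∧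
    ∀ x : M.toStarSubalgebra, τ x = ∑' n, ⟪η n, (x : H →L[ℂ] H) (ξ n)⟫_ℂ

/-! ### Free Brownian motion -/

/-- The joint moments of a centered semicircular family of covariance `K`: the moment of the word
`i₁ ⋯ iₙ` is the sum over all noncrossing pair partitions of `{1, …, n}` of the product over the
blocks `{a < b}` of `K i_a i_b`. The sum is organized by the partner `k` of the first letter: a
noncrossing pairing consists of that block, a noncrossing pairing of the letters in between and a
noncrossing pairing of the letters after `k`. -/
noncomputable def semicircularMoment {ι : Type*} (K : ι → ι → ℝ) : List ι → ℝ
  | [] => 1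
  | i :: w => ∑ k : Fin w.length, K i (w.get k) *
      semicircularMoment K (w.take k) * semicircularMoment K (w.drop (k + 1))
termination_by w => w.length
decreasing_by
  · simp only [List.length_take, List.length_cons]; omega
  · simp only [List.length_drop, List.length_cons]; omega

/-- A free Brownian motion in the noncommutative probability space `(M, τ)`: a family `(S_t)_{t ≥ 0}`
of self-adjoint elements that is a centered semicircular process of covariance `min s t`. -/
structure IsFreeBrownianMotion {H : Type u} [NormedAddCommGroup H] [InnerProductSpace ℂ H]
    [CompleteSpace H] (M : VonNeumannAlgebra H) (τ : M.toStarSubalgebra →ₗ[ℂ] ℂ)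
    (S : ℝ≥0 → M.toStarSubalgebra) : Prop where
  selfAdjoint : ∀ t, IsSelfAdjoint (S t)
  moments : ∀ w : List ℝ≥0,
    τ (w.map S).prod = (semicircularMoment (fun s t => ((min s t : ℝ≥0) : ℝ)) w : ℂ)

/-! ### The Wigner space -/

/-- Lebesgue measure on `ℝ₊ = [0, ∞)`. -/
noncomputable abbrev halfLine : Measure ℝ := volume.restrict (Set.Ici 0)

/-- `L²_ℂ(ℝ₊)`, the complexification of `L²_ℝ(ℝ₊)`. -/
abbrev L2C : Type := Lp ℂ 2 halfLine

/-- The inclusion of `L²_ℝ(ℝ₊)` into its complexification `L²_ℂ(ℝ₊)`. -/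
noncomputable def realToComplex (h : Lp ℝ 2 halfLine) : L2C :=
  Complex.ofRealCLM.compLp h

/-- The indicator function `1_{[0,t]}` in `L²_ℂ(ℝ₊)`. -/
noncomputable def indicatorIcc (t : ℝ≥0) : L2C :=
  indicatorConstLp 2 (measurableSet_Icc (a := (0 : ℝ)) (b := (t : ℝ)))
    (Measure.restrict_apply_le _ _ |>.trans_lt measure_Icc_lt_top).ne (1 : ℂ)

/-- The free Brownian motion on the Wigner space: `S_t = S(1_{[0,t]})`. -/
noncomputable def wignerBM (t : ℝ≥0) : FreeFock.Fock L2C →L[ℂ] FreeFock.Fock L2C :=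
  FreeFock.semicircular (indicatorIcc t)

/-! Let `φ` be the state on the algebra generated by the Brownian motion `T`. It is a trace, because
semicircular moments are invariant under cyclic rotation of words. Let `X` be the increment of `T`
over `[n, n + 1]`, let `P` be a word, and put `W = X P X - X X P`. For a polynomial `a` in the
process and `n` beyond all times in `P` and `a`, the two increment letters can only be paired with
each other, so `φ (W a) = φ P * φ a - φ (P a)`. If `z` is central, traciality gives `φ (W z) = 0`.
Since `φ (W W*)` is eventually constant in `n`, replacing `z` by an `L²`-close polynomial `a` costs
an error that is uniform in `n`; hence `φ (P z) = φ P * φ z` (`map_mul_eq_of_mem_center`). By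
density this holds with `P` replaced by `z*`, so `z` has variance zero and faithfulness makes it a
scalar (`isFactor_of_semicircularMoment`).

Passing from polynomials to the von Neumann algebra uses the double commutant theorem on multiples
of `H` (`amplify_mem_closure`). On the Wigner space the vacuum has the required moments and is
cyclic; being tracial as well, it is separating, hence faithful. The two Wigner algebras agree
because `S(h)` is real-linear and norm continuous in `h` and the indicators are total. -/

/-! ### Sums over the splittings of a list -/

section SplitSum

variable {ι A B : Type*} [AddCommMonoid A] [AddCommMonoid B]

/-- The sum of `F u x v` over all decompositions `w = u ++ x :: v`. -/
def splitSum (F : List ι → ι → List ι → A) : List ι → A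
  | [] => 0
  | x :: w => F [] x w + splitSum (fun u y v => F (x :: u) y v) w

@[simp] theorem splitSum_nil (F : List ι → ι → List ι → A) : splitSum F [] = 0 := rfl

@[simp] theorem splitSum_cons (F : List ι → ι → List ι → A) (x : ι) (w : List ι) :
    splitSum F (x :: w) = F [] x w + splitSum (fun u y v => F (x :: u) y v) w := rfl

/-- This trades the `Fin`-indexed sum in the definition of the moments for a structural recursion,
in which concatenating words needs no index arithmetic. -/
theorem sum_fin_eq_splitSum (F : List ι → ι → List ι → A) (w : List ι) :
    ∑ k : Fin w.length, F (w.take k) (w.get k) (w.drop (k + 1)) = splitSum F w := by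
  induction w generalizing F with
  | nil => simp
  | cons x w ih =>
    rw [splitSum_cons, ← ih]
    exact Fin.sum_univ_succ (n := w.length) _

theorem splitSum_congr {F G : List ι → ι → List ι → A} {w : List ι}
    (h : ∀ u x v, w = u ++ x :: v → F u x v = G u x v) : splitSum F w = splitSum G w := by
  induction w generalizing F G with
  | nil => rfl
  | cons x w ih =>
    rw [splitSum_cons, splitSum_cons, h [] x w rfl]
    congr 1
    exact ih fun u y v huv => h (x :: u) y v (by rw [huv, List.cons_append])

theorem splitSum_zero (w : List ι) : splitSum (fun _ _ _ => (0 : A)) w = 0 := by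
  induction w with
  | nil => rfl
  | cons x w ih => rw [splitSum_cons, ih, add_zero]

theorem splitSum_add (F G : List ι → ι → List ι → A) (w : List ι) :
    splitSum (fun u x v => F u x v + G u x v) w = splitSum F w + splitSum G w := by
  induction w generalizing F G with
  | nil => simp
  | cons x w ih =>
    simp only [splitSum_cons]
    rw [ih]
    abel

theorem map_splitSum (f : A →+ B) (F : List ι → ι → List ι → A) (w : List ι) :
    f (splitSum F w) = splitSum (fun u x v => f (F u x v)) w := by
  induction w generalizing F with
  | nil => simp
  | cons x w ih => rw [splitSum_cons, splitSum_cons, map_add, ih]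

theorem mul_splitSum {R : Type*} [NonUnitalNonAssocSemiring R] (c : R)
    (F : List ι → ι → List ι → R) (w : List ι) :
    c * splitSum F w = splitSum (fun u x v => c * F u x v) w :=
  map_splitSum (AddMonoidHom.mulLeft c) F w

theorem splitSum_mul {R : Type*} [NonUnitalNonAssocSemiring R] (c : R)
    (F : List ι → ι → List ι → R) (w : List ι) :
    splitSum F w * c = splitSum (fun u x v => F u x v * c) w :=
  map_splitSum (AddMonoidHom.mulRight c) F w

theorem splitSum_append (F : List ι → ι → List ι → A) (w₁ w₂ : List ι) :
    splitSum F (w₁ ++ w₂) = splitSum (fun u x v => F u x (v ++ w₂)) w₁ +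
      splitSum (fun u x v => F (w₁ ++ u) x v) w₂ := by
  induction w₁ generalizing F with
  | nil => simp
  | cons x w ih => rw [List.cons_append, splitSum_cons, splitSum_cons, ih, add_assoc]; rfl

theorem splitSum_map {κ : Type*} (f : κ → ι) (F : List ι → ι → List ι → A) (w : List κ) :
    splitSum F (w.map f) = splitSum (fun u x v => F (u.map f) (f x) (v.map f)) w := by
  induction w generalizing F with
  | nil => rfl
  | cons x w ih => rw [List.map_cons, splitSum_cons, splitSum_cons, ih]; rfl

/-- A decomposition with two marked letters can be organized by either of them. -/
theorem splitSum_comm (G : List ι → ι → List ι → ι → List ι → A) (w : List ι) :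
    splitSum (fun u x v => splitSum (fun u' y v' => G u x u' y v') v) w =
      splitSum (fun p y v' => splitSum (fun u x u' => G u x u' y v') p) w := by
  induction w generalizing G with
  | nil => rfl
  | cons a w ih =>
    simp only [splitSum_cons, splitSum_nil, zero_add]
    rw [splitSum_add, ih]

end SplitSum

/-! ### Moments of semicircular families -/

section Moments

variable {ι : Type*} {K : ι → ι → ℝ}

@[simp] theorem semicircularMoment_nil (K : ι → ι → ℝ) : semicircularMoment K [] = 1 := by
  rw [semicircularMoment]

theorem semicircularMoment_cons (K : ι → ι → ℝ) (i : ι) (w : List ι) :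
    semicircularMoment K (i :: w) =
      splitSum (fun u x v => K i x * semicircularMoment K u * semicircularMoment K v) w := by
  rw [semicircularMoment, ← sum_fin_eq_splitSum]

/-- Expansion of a moment along the partner of the last letter. -/
theorem semicircularMoment_concat (K : ι → ι → ℝ) (w : List ι) (i : ι) :
    semicircularMoment K (w ++ [i]) =
      splitSum (fun u x v => K x i * semicircularMoment K u * semicircularMoment K v) w := by
  induction hn : w.length using Nat.strong_induction_on generalizing w with
  | _ n ih =>
    cases w with
    | nil => simp [semicircularMoment_cons]
    | cons j w =>
      rw [List.cons_append, semicircularMoment_cons, splitSum_append, splitSum_cons]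
      simp only [splitSum_cons, splitSum_nil, List.append_nil, semicircularMoment_nil, mul_one,
        add_zero]
      rw [add_comm]
      congr 1
      -- What remains are the pairings in which `j` and `i` are not partners. The partner `y` of `i`
      -- lies to the right of the partner `x` of `j`; summing over `y` outermost reassembles the
      -- moment of `j :: p`.
      have h1 : splitSum (fun u x v => K j x * semicircularMoment K u *
          semicircularMoment K (v ++ [i])) w = splitSum (fun u x v => splitSum (fun u' y v' =>
            K j x * semicircularMoment K u *
            (K y i * semicircularMoment K u' * semicircularMoment K v')) v) w := by
        refine splitSum_congr fun u x v huv => ?_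
        rw [ih v.length (by rw [← hn, huv]; simp; omega) v rfl, mul_splitSum]
      rw [h1, splitSum_comm]
      refine splitSum_congr fun p y v' _ => ?_
      rw [semicircularMoment_cons, mul_splitSum, splitSum_mul]
      exact splitSum_congr fun _ _ _ _ => by ring

theorem semicircularMoment_cons_eq_concat (hK : ∀ i j, K i j = K j i) (i : ι) (w : List ι) :
    semicircularMoment K (i :: w) = semicircularMoment K (w ++ [i]) := by
  rw [semicircularMoment_cons, semicircularMoment_concat]
  exact splitSum_congr fun u x v _ => by rw [hK]

/-- Traciality of the moments of a semicircular family. -/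
theorem semicircularMoment_append_comm (hK : ∀ i j, K i j = K j i) (v w : List ι) :
    semicircularMoment K (v ++ w) = semicircularMoment K (w ++ v) := by
  induction v generalizing w with
  | nil => simp
  | cons i v ih =>
    rw [List.cons_append, semicircularMoment_cons_eq_concat hK, List.append_assoc, ih,
      List.append_assoc, List.singleton_append]

/-- Only covariances between letters of the word enter the recursion. This later replaces the
covariance of a late increment by one that does not depend on `n`. -/
theorem semicircularMoment_congr {K' : ι → ι → ℝ} {w : List ι}
    (h : ∀ i ∈ w, ∀ j ∈ w, K i j = K' i j) :
    semicircularMoment K w = semicircularMoment K' w := by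
  induction hn : w.length using Nat.strong_induction_on generalizing w with
  | _ n ih =>
    cases w with
    | nil => simp
    | cons i w =>
      rw [semicircularMoment_cons, semicircularMoment_cons]
      refine splitSum_congr fun u x v huv => ?_
      subst huv
      rw [h i (by simp) x (by simp),
        ih u.length (by rw [← hn]; simp)
          (fun a ha b hb => h a (by simp [ha]) b (by simp [hb])) rfl,
        ih v.length (by rw [← hn]; simp; omega)
          (fun a ha b hb => h a (by simp [ha]) b (by simp [hb])) rfl]

theorem semicircularMoment_map {κ : Type*} (f : κ → ι) (w : List κ) :
    semicircularMoment K (w.map f) = semicircularMoment (fun i j => K (f i) (f j)) w := by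
  induction hn : w.length using Nat.strong_induction_on generalizing w with
  | _ n ih =>
    cases w with
    | nil => simp
    | cons i w =>
      rw [List.map_cons, semicircularMoment_cons, semicircularMoment_cons, splitSum_map]
      refine splitSum_congr fun u x v huv => ?_
      subst huv
      rw [ih u.length (by rw [← hn]; simp) u rfl,
        ih v.length (by rw [← hn]; simp; omega) v rfl]

/-- The moments are linear in each letter. -/
theorem semicircularMoment_sub {x y z : ι} (hl : ∀ i, K x i = K y i - K z i)
    (hr : ∀ i, K i x = K i y - K i z) (u v : List ι) :
    semicircularMoment K (u ++ x :: v) =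
      semicircularMoment K (u ++ y :: v) - semicircularMoment K (u ++ z :: v) := by
  induction hn : u.length + v.length using Nat.strong_induction_on generalizing u v with
  | _ n ih =>
    rw [sub_eq_add_neg, ← neg_one_mul]
    cases u with
    | nil =>
      simp only [List.nil_append, semicircularMoment_cons]
      rw [mul_splitSum, ← splitSum_add]
      exact splitSum_congr fun _ _ _ _ => by rw [hl]; ring
    | cons a u =>
      simp only [List.cons_append, semicircularMoment_cons, splitSum_append, splitSum_cons,
        List.append_nil]
      -- Relative to the pair of `a` and its partner, `x` lies to the right (`h1`), is enclosed
      -- (`h2`), or is the partner itself (`hr`).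
      have h1 : splitSum (fun p i q => K a i * semicircularMoment K p *
            semicircularMoment K (q ++ x :: v)) u =
          splitSum (fun p i q => K a i * semicircularMoment K p *
            semicircularMoment K (q ++ y :: v)) u +
          -1 * splitSum (fun p i q => K a i * semicircularMoment K p *
            semicircularMoment K (q ++ z :: v)) u := by
        rw [mul_splitSum, ← splitSum_add]
        refine splitSum_congr fun p i q hpq => ?_
        rw [ih (q.length + v.length) (by rw [← hn, hpq]; simp; omega) q v rfl]
        ring
      have h2 : splitSum (fun p i q => K a i * semicircularMoment K (u ++ x :: p) *
            semicircularMoment K q) v =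
          splitSum (fun p i q => K a i * semicircularMoment K (u ++ y :: p) *
            semicircularMoment K q) v +
          -1 * splitSum (fun p i q => K a i * semicircularMoment K (u ++ z :: p) *
            semicircularMoment K q) v := by
        rw [mul_splitSum, ← splitSum_add]
        refine splitSum_congr fun p i q hpq => ?_
        rw [ih (u.length + p.length) (by rw [← hn, hpq]; simp; omega) u p rfl]
        ring
      rw [h1, h2, hr]
      ring

/-- A pair of letters of variance one that is orthogonal to all other letters must be matched. -/
theorem semicircularMoment_cons_append_cons {e : ι} (he : K e e = 1) {u v : List ι}
    (hu : ∀ i ∈ u, K e i = 0) (hv : ∀ i ∈ v, K e i = 0) :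
    semicircularMoment K (e :: (u ++ e :: v)) =
      semicircularMoment K u * semicircularMoment K v := by
  rw [semicircularMoment_cons, splitSum_append, splitSum_cons, List.append_nil, he, one_mul]
  have h1 : ∀ F : List ι → ι → List ι → ℝ,
      splitSum (fun p i q => K e i * F p i q) u = 0 := fun F => by
    rw [← splitSum_zero u]
    exact splitSum_congr fun p i q h => by rw [hu i (by simp [h]), zero_mul]
  have h2 : ∀ F : List ι → ι → List ι → ℝ,
      splitSum (fun p i q => K e i * F p i q) v = 0 := fun F => by
    rw [← splitSum_zero v]
    exact splitSum_congr fun p i q h => by rw [hv i (by simp [h]), zero_mul]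
  simp only [mul_assoc]
  rw [h1, h2, zero_add, add_zero]

end Moments

/-! ### Amplifications and ultraweakly continuous functionals -/

section Amplification

variable {H : Type u} [NormedAddCommGroup H] [InnerProductSpace ℂ H]

/-- The Hilbert space direct sum of copies of `H` indexed by `ι`. -/
abbrev HilbertMultiple (H : Type u) [NormedAddCommGroup H] [InnerProductSpace ℂ H]
    (ι : Type) : Type u := lp (fun _ : ι => H) 2

theorem summable_norm_sq {ι : Type} (v : HilbertMultiple H ι) : Summable fun i => ‖v i‖ ^ 2 := by
  simpa using (lp.memℓp v).summable (by norm_num)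

theorem hilbertMultiple_norm_sq {ι : Type} (v : HilbertMultiple H ι) :
    ‖v‖ ^ 2 = ∑' i, ‖v i‖ ^ 2 := by
  simpa using lp.norm_rpow_eq_tsum (p := 2) (by norm_num) v

theorem memℓp_two_of_summable {E : Type*} [NormedAddCommGroup E] {ι : Type} {f : ι → E}
    (hf : Summable fun i => ‖f i‖ ^ 2) :
    Memℓp f 2 :=
  memℓp_gen (by simpa using hf)

/-- The diagonal action of a bounded operator on a multiple of `H`. -/
noncomputable def amplify (ι : Type) (x : H →L[ℂ] H) :
    HilbertMultiple H ι →L[ℂ] HilbertMultiple H ι :=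
  have hle (v : HilbertMultiple H ι) (i : ι) : ‖x (v i)‖ ^ 2 ≤ ‖x‖ ^ 2 * ‖v i‖ ^ 2 := by
    rw [← mul_pow]
    exact pow_le_pow_left₀ (norm_nonneg _) (x.le_opNorm _) 2
  have hs (v : HilbertMultiple H ι) : Summable fun i => ‖x (v i)‖ ^ 2 :=
    Summable.of_nonneg_of_le (fun i => by positivity) (hle v)
      ((summable_norm_sq v).mul_left (‖x‖ ^ 2))
  LinearMap.mkContinuous
    { toFun := fun v => ⟨fun i => x (v i), memℓp_two_of_summable (hs v)⟩
      map_add' := fun v w => by ext i; exact map_add x (v i) (w i)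
      map_smul' := fun c v => by ext i; exact map_smul x c (v i) }
    ‖x‖ fun v => by
      refine (sq_le_sq₀ (norm_nonneg _) (by positivity)).1 ?_
      rw [hilbertMultiple_norm_sq, mul_pow, hilbertMultiple_norm_sq v, ← tsum_mul_left]
      exact Summable.tsum_le_tsum (hle v) (hs v) ((summable_norm_sq v).mul_left _)

variable {ι : Type}

@[simp] theorem amplify_apply (x : H →L[ℂ] H) (v : HilbertMultiple H ι) (i : ι) :
    amplify ι x v i = x (v i) := rfl

theorem amplify_mul (x y : H →L[ℂ] H) (v : HilbertMultiple H ι) :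
    amplify ι (x * y) v = amplify ι x (amplify ι y v) := rfl

theorem amplify_sub (x y : H →L[ℂ] H) (v : HilbertMultiple H ι) :
    amplify ι (x - y) v = amplify ι x v - amplify ι y v := rfl

theorem amplify_single [DecidableEq ι] (x : H →L[ℂ] H) (i : ι) (h : H) :
    amplify ι x (lp.single 2 i h) = lp.single 2 i (x h) := by
  ext j
  by_cases hj : j = i
  · subst hj; simp
  · simp [hj]

/-- The evaluation of the amplification at a vector. -/
noncomputable def amplifyEval (v : HilbertMultiple H ι) : (H →L[ℂ] H) →ₗ[ℂ] HilbertMultiple H ι where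
  toFun x := amplify ι x v
  map_add' _ _ := rfl
  map_smul' _ _ := rfl

/-- Concatenation of square summable families. -/
theorem exists_glue {κ : Type} (v : HilbertMultiple H ι) (w : HilbertMultiple H κ) :
    ∃ g : HilbertMultiple H (ι ⊕ κ), (∀ i, g (.inl i) = v i) ∧ ∀ k, g (.inr k) = w k :=
  ⟨⟨Sum.elim v w, memℓp_two_of_summable
    (Summable.sum _ (summable_norm_sq v) (summable_norm_sq w))⟩, fun _ => rfl, fun _ => rfl⟩

/-- A functional on `B(H)` of the form `x ↦ ∑ ⟪η i, x (ξ i)⟫` with square summable `ξ`, `η`. -/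
def IsUltraweak (ψ : (H →L[ℂ] H) → ℂ) : Prop :=
  ∃ (ι : Type) (ξ η : HilbertMultiple H ι), ∀ x, ψ x = ⟪η, amplify ι x ξ⟫_ℂ

namespace IsUltraweak

variable {ψ ψ' : (H →L[ℂ] H) → ℂ}

theorem sub (h : IsUltraweak ψ) (h' : IsUltraweak ψ') : IsUltraweak fun x => ψ x - ψ' x := by
  obtain ⟨ι, ξ, η, h⟩ := h
  obtain ⟨κ, ξ', η', h'⟩ := h'
  obtain ⟨g, hg, hg'⟩ := exists_glue ξ ξ'
  obtain ⟨k, hk, hk'⟩ := exists_glue η (-η')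
  refine ⟨ι ⊕ κ, g, k, fun x => ?_⟩
  have h1 : HasSum ((fun i => ⟪k i, amplify _ x g i⟫_ℂ) ∘ Sum.inl) (ψ x) := by
    have e : ((fun i => ⟪k i, amplify _ x g i⟫_ℂ) ∘ Sum.inl) =
        fun i => ⟪η i, amplify ι x ξ i⟫_ℂ := by
      funext i
      simp only [Function.comp_apply, amplify_apply, hg, hk]
    rw [h, e]
    exact lp.hasSum_inner η (amplify ι x ξ)
  have h2 : HasSum ((fun i => ⟪k i, amplify _ x g i⟫_ℂ) ∘ Sum.inr) (-ψ' x) := by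
    have e : ((fun i => ⟪k i, amplify _ x g i⟫_ℂ) ∘ Sum.inr) =
        fun i => ⟪(-η') i, amplify κ x ξ' i⟫_ℂ := by
      funext i
      simp only [Function.comp_apply, amplify_apply, hg', hk']
    rw [h', e, ← inner_neg_left]
    exact lp.hasSum_inner (-η') (amplify κ x ξ')
  exact (sub_eq_add_neg (ψ x) (ψ' x)).trans
    ((h1.sum h2).unique (lp.hasSum_inner k (amplify _ x g)))

theorem mul_const (h : IsUltraweak ψ) (c : ℂ) : IsUltraweak fun x => ψ x * c := by
  obtain ⟨ι, ξ, η, h⟩ := h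
  exact ⟨ι, c • ξ, η, fun x => by
    rw [map_smul, inner_smul_right, mul_comm, ← h]⟩

end IsUltraweak

/-! ### Double commutant theorem and approximation by polynomials -/

variable [CompleteSpace H]

theorem inner_amplify_right (x : H →L[ℂ] H) (v w : HilbertMultiple H ι) :
    ⟪v, amplify ι x w⟫_ℂ = ⟪amplify ι (star x) v, w⟫_ℂ := by
  rw [lp.inner_eq_tsum, lp.inner_eq_tsum]
  exact tsum_congr fun i => (ContinuousLinearMap.adjoint_inner_left x (w i) (v i)).symm

theorem mem_generatedVN_iff {s : Set (H →L[ℂ] H)} {x : H →L[ℂ] H} :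
    x ∈ generatedVN s ↔ ∀ y ∈ StarSubalgebra.centralizer ℂ s, y * x = x * y := by
  change x ∈ StarSubalgebra.centralizer ℂ (StarSubalgebra.centralizer ℂ s : Set (H →L[ℂ] H)) ↔ _
  rw [StarSubalgebra.mem_centralizer_iff]
  exact ⟨fun h y hy => (h y hy).1, fun h y hy => ⟨h y hy, h _ (star_mem hy)⟩⟩

theorem adjoin_le_generatedVN (s : Set (H →L[ℂ] H)) :
    StarAlgebra.adjoin ℂ s ≤ (generatedVN s).toStarSubalgebra :=
  StarAlgebra.adjoin_le_centralizer_centralizer ℂ s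

/-- The double commutant theorem, for the ultrastrong topology. -/
theorem amplify_mem_closure {s : Set (H →L[ℂ] H)} {x : H →L[ℂ] H} (hx : x ∈ generatedVN s)
    (v : HilbertMultiple H ι) :
    amplify ι x v ∈ closure ((fun a => amplify ι a v) '' (StarAlgebra.adjoin ℂ s : Set (H →L[ℂ] H))) := by
  classical
  set A := StarAlgebra.adjoin ℂ s with hA
  let K₀ : Submodule ℂ (HilbertMultiple H ι) :=
    (Subalgebra.toSubmodule A.toSubalgebra).map (amplifyEval v)
  let K := K₀.topologicalClosure
  have hKc : IsClosed (K : Set (HilbertMultiple H ι)) := K₀.isClosed_topologicalClosure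
  have : CompleteSpace K := hKc.completeSpace_coe
  have hinv : ∀ a ∈ A, ∀ w ∈ K, amplify ι a w ∈ K := by
    intro a ha
    have : K₀ ≤ K.comap (amplify ι a : HilbertMultiple H ι →ₗ[ℂ] HilbertMultiple H ι) := by
      rintro _ ⟨b, hb, rfl⟩
      exact K₀.le_topologicalClosure ⟨a * b, A.mul_mem ha hb, rfl⟩
    have hcl : IsClosed (K.comap (amplify ι a : HilbertMultiple H ι →ₗ[ℂ] HilbertMultiple H ι) :
        Set (HilbertMultiple H ι)) := hKc.preimage (amplify ι a).continuous
    exact fun w hw => K₀.topologicalClosure_minimal this hcl hw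
  -- `K` is invariant under the self-adjoint algebra `A`, hence so is its orthogonal complement, and
  -- the projection onto `K` commutes with `A`.
  have hcomm : ∀ a ∈ A, ∀ w, K.starProjection (amplify ι a w) = amplify ι a (K.starProjection w) := by
    intro a ha w
    refine (Submodule.eq_starProjection_of_mem_orthogonal
      (hinv a ha _ (K.starProjection_apply_mem w)) ?_)
    rw [← map_sub, Submodule.mem_orthogonal]
    intro y hy
    rw [inner_amplify_right]
    exact (Submodule.mem_orthogonal _ _).1 (K.sub_starProjection_mem_orthogonal w) _
      (hinv _ (star_mem ha) y hy)
  have hx' : amplify ι x ∘L K.starProjection = K.starProjection ∘L amplify ι x := by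
    refine lp.ext_continuousLinearMap (by norm_num) fun j => ?_
    ext h i
    -- A matrix entry of the projection. It commutes with `A` because the amplification is diagonal,
    -- so it lies in the commutant of `s` and therefore commutes with `x`.
    let p : H →L[ℂ] H := lp.evalCLM ℂ (fun _ : ι => H) 2 i ∘L K.starProjection ∘L
      lp.singleContinuousLinearMap ℂ (fun _ : ι => H) 2 j
    have hp : p ∈ StarSubalgebra.centralizer ℂ s := by
      have key : ∀ g ∈ A, g * p = p * g := by
        intro g hg
        ext k
        change g (K.starProjection (lp.single 2 j k) i) = K.starProjection (lp.single 2 j (g k)) i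
        rw [← amplify_single, hcomm g hg, amplify_apply]
      rw [StarSubalgebra.mem_centralizer_iff]
      intro g hg
      have hgA : g ∈ A := StarAlgebra.subset_adjoin ℂ s hg
      exact ⟨key g hgA, key _ (star_mem hgA)⟩
    have hpx := DFunLike.congr_fun (mem_generatedVN_iff.1 hx p hp) h
    change p (x h) = x (p h) at hpx
    change x (p h) = K.starProjection (amplify ι x (lp.single 2 j h)) i
    rw [← hpx, amplify_single]
    rfl
  have hv : v ∈ K := K₀.le_topologicalClosure ⟨1, one_mem A, rfl⟩
  have h1 : amplify ι x v ∈ K := by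
    have := DFunLike.congr_fun hx' v
    simp only [ContinuousLinearMap.comp_apply] at this
    rw [Submodule.starProjection_eq_self_iff.2 hv] at this
    rw [this]
    exact K.starProjection_apply_mem _
  exact h1

namespace IsUltraweak

variable {ψ : (H →L[ℂ] H) → ℂ}

theorem comp_mul (h : IsUltraweak ψ) (a b : H →L[ℂ] H) : IsUltraweak fun x => ψ (a * x * b) := by
  obtain ⟨ι, ξ, η, h⟩ := h
  refine ⟨ι, amplify ι b ξ, amplify ι (star a) η, fun x => ?_⟩
  rw [← inner_amplify_right, ← amplify_mul, ← amplify_mul, ← h]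

theorem comp_mul_left (h : IsUltraweak ψ) (a : H →L[ℂ] H) : IsUltraweak fun x => ψ (a * x) := by
  simpa using h.comp_mul a 1

theorem comp_mul_right (h : IsUltraweak ψ) (b : H →L[ℂ] H) : IsUltraweak fun x => ψ (x * b) := by
  simpa using h.comp_mul 1 b

/-- An ultraweak functional sees `x` only through one vector of a multiple of `H`, where `x` is
approximated by polynomials. Every identity proved on words is extended through this lemma. -/
theorem eq_zero_of_mem_generatedVN (h : IsUltraweak ψ) {s : Set (H →L[ℂ] H)}
    (hs : ∀ a ∈ StarAlgebra.adjoin ℂ s, ψ a = 0) {x : H →L[ℂ] H} (hx : x ∈ generatedVN s) :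
    ψ x = 0 := by
  obtain ⟨ι, ξ, η, h⟩ := h
  rw [h]
  have hcl : IsClosed {w : HilbertMultiple H ι | ⟪η, w⟫_ℂ = 0} :=
    isClosed_eq (continuous_const.inner continuous_id) continuous_const
  refine closure_minimal ?_ hcl (amplify_mem_closure hx ξ)
  rintro _ ⟨a, ha, rfl⟩
  exact (h a).symm.trans (hs a ha)

theorem exists_adjoin_approx (h : IsUltraweak ψ) {s : Set (H →L[ℂ] H)} {x : H →L[ℂ] H}
    (hx : x ∈ generatedVN s) {ε : ℝ} (hε : 0 < ε) :
    ∃ a ∈ StarAlgebra.adjoin ℂ s, ‖ψ (star (x - a) * (x - a))‖ < ε ^ 2 := by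
  obtain ⟨ι, ξ, η, h⟩ := h
  -- Gluing `ξ` and `η` makes one polynomial `a` approximate `x` on both vectors, so the inner
  -- product of the two small images is of order `ε ^ 2`.
  obtain ⟨g, hg, hg'⟩ := exists_glue ξ η
  obtain ⟨_, ⟨a, ha, rfl⟩, hag⟩ := Metric.mem_closure_iff.1 (amplify_mem_closure hx g) ε hε
  rw [dist_eq_norm, ← amplify_sub] at hag
  refine ⟨a, ha, ?_⟩
  set y := x - a
  have hs := summable_norm_sq (amplify _ y g)
  have hle : ‖amplify ι y ξ‖ ^ 2 + ‖amplify ι y η‖ ^ 2 = ‖amplify _ y g‖ ^ 2 := by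
    rw [hilbertMultiple_norm_sq, hilbertMultiple_norm_sq, hilbertMultiple_norm_sq (amplify _ y g),
      Summable.tsum_sum (hs.comp_injective Sum.inl_injective)
        (hs.comp_injective Sum.inr_injective)]
    simp [hg, hg']
  rw [h, amplify_mul, inner_amplify_right, star_star]
  refine (norm_inner_le_norm _ _).trans_lt ?_
  nlinarith [norm_nonneg (amplify _ y g), norm_nonneg (amplify ι y ξ),
    norm_nonneg (amplify ι y η), sq_nonneg (‖amplify ι y ξ‖ - ‖amplify ι y η‖),
    pow_lt_pow_left₀ hag (norm_nonneg _) two_ne_zero]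

end IsUltraweak

end Amplification

/-! ### Positive and tracial functionals -/

section Functionals

variable {H : Type u} [NormedAddCommGroup H] [InnerProductSpace ℂ H] [CompleteSpace H]
  {M : VonNeumannAlgebra H} {φ : (H →L[ℂ] H) →ₗ[ℂ] ℂ}

/-- Polarization: positivity at `1 + x` and `1 + i x` forces `φ x + φ (star x)` and `i (φ x - φ
(star x))` to be real. -/
theorem map_star_of_nonneg (hφ : ∀ x ∈ M, 0 ≤ φ (star x * x)) {x : H →L[ℂ] H} (hx : x ∈ M) :
    φ (star x) = starRingEnd ℂ (φ x) := by
  have h0 := (Complex.nonneg_iff.1 (hφ x hx)).2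
  have h1 := (Complex.nonneg_iff.1 (hφ 1 (one_mem M))).2
  have h2 := (Complex.nonneg_iff.1 (hφ (1 + x) (add_mem (one_mem M) hx))).2
  have h3 := (Complex.nonneg_iff.1 (hφ (1 + Complex.I • x)
    (add_mem (one_mem M) (M.toStarSubalgebra.smul_mem hx _)))).2
  have e2 : star (1 + x) * (1 + x) = 1 + x + star x + star x * x := by
    rw [star_add, star_one]; noncomm_ring
  have e3 : star (1 + Complex.I • x) * (1 + Complex.I • x) =
      1 + Complex.I • x - Complex.I • star x + star x * x := by
    rw [star_add, star_one, star_smul]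
    simp only [add_mul, mul_add, one_mul, mul_one, smul_mul_smul_comm]
    simp only [Complex.star_def, Complex.conj_I, neg_mul, Complex.I_mul_I, neg_neg, one_smul, neg_smul]
    abel
  rw [e2] at h2
  rw [e3] at h3
  simp only [map_add, map_sub, map_smul, star_one, mul_one, smul_eq_mul, Complex.add_im,
    Complex.sub_im, Complex.mul_im, Complex.I_re, Complex.I_im] at h0 h1 h2 h3
  apply Complex.ext
  · rw [Complex.conj_re]; linarith
  · rw [Complex.conj_im]; linarith

/-- The Cauchy-Schwarz inequality for a positive functional. -/
theorem norm_map_mul_le (hφ : ∀ x ∈ M, 0 ≤ φ (star x * x)) {x y : H →L[ℂ] H} (hx : x ∈ M)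
    (hy : y ∈ M) :
    ‖φ (x * y)‖ ≤ √‖φ (x * star x)‖ * √‖φ (star y * y)‖ := by
  let core : PreInnerProductSpace.Core ℂ M.toStarSubalgebra :=
    { inner := fun a b => φ (star (a : H →L[ℂ] H) * b)
      conj_inner_symm := fun a b => by
        rw [← map_star_of_nonneg hφ (mul_mem (star_mem b.2) a.2), star_mul, star_star]
      re_inner_nonneg := fun a => (Complex.nonneg_iff.1 (hφ a a.2)).1
      add_left := fun a b c => by
        change φ (star ((a : H →L[ℂ] H) + b) * c) = _
        rw [star_add, add_mul, map_add]
      smul_left := fun a b r => by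
        change φ (star (r • (a : H →L[ℂ] H)) * b) = _
        rw [star_smul, smul_mul_assoc, map_smul]
        rfl }
  -- The form `φ (a* b)` may be degenerate, so only a pre-inner product is available; it is applied
  -- to the pair `star x`, `y`.
  have h := @InnerProductSpace.Core.inner_mul_inner_self_le ℂ M.toStarSubalgebra _ _ _ core
    ⟨star x, star_mem hx⟩ ⟨y, hy⟩
  change ‖φ (star (star x) * y)‖ * ‖φ (star y * star x)‖ ≤
    (φ (star (star x) * star x)).re * (φ (star y * y)).re at h
  rw [← star_mul, map_star_of_nonneg hφ (mul_mem hx hy), RCLike.norm_conj, star_star] at h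
  rw [← Real.sqrt_mul (norm_nonneg _)]
  refine Real.le_sqrt_of_sq_le ?_
  rw [sq]
  refine h.trans (mul_le_mul (Complex.re_le_norm _) (Complex.re_le_norm _) ?_ (norm_nonneg _))
  exact (Complex.nonneg_iff.1 (hφ y hy)).1

variable {κ : Type*} {T : κ → H →L[ℂ] H}

theorem star_prod_map (hT : ∀ t, IsSelfAdjoint (T t)) (w : List κ) :
    star (w.map T).prod = (w.reverse.map T).prod := by
  induction w with
  | nil => simp
  | cons t w ih => simp [star_mul, ih, (hT t).star_eq]

theorem prod_map_mem_adjoin (w : List κ) :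
    (w.map T).prod ∈ StarAlgebra.adjoin ℂ (Set.range T) :=
  Submonoid.list_prod_mem _ fun x hx => by
    obtain ⟨t, _, rfl⟩ := List.mem_map.1 hx
    exact StarAlgebra.subset_adjoin ℂ _ ⟨t, rfl⟩

/-- The algebra generated by self-adjoint elements is spanned by the words. -/
theorem mem_span_words (hT : ∀ t, IsSelfAdjoint (T t)) {a : H →L[ℂ] H}
    (ha : a ∈ StarAlgebra.adjoin ℂ (Set.range T)) :
    a ∈ Submodule.span ℂ (Set.range fun w : List κ => (w.map T).prod) := by
  have hs : Set.range T ∪ star (Set.range T) = Set.range T := by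
    refine Set.union_eq_left.2 fun x hx => ?_
    obtain ⟨t, ht⟩ := hx
    exact ⟨t, by rw [← star_star x, ← ht, (hT t).star_eq]⟩
  have ha' : a ∈ Subalgebra.toSubmodule (Algebra.adjoin ℂ (Set.range T)) := by
    rw [← hs, ← StarAlgebra.adjoin_toSubalgebra]
    exact ha
  rw [Algebra.adjoin_eq_span] at ha'
  refine Submodule.span_mono ?_ ha'
  intro x hx
  obtain ⟨l, hl, rfl⟩ := Submonoid.exists_list_of_mem_closure hx
  obtain ⟨w, rfl⟩ : ∃ w : List κ, w.map T = l := by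
    change l ∈ Set.range (List.map T)
    rw [Set.range_list_map]
    exact hl
  exact ⟨w, rfl⟩

/-- A functional that is tracial on words is tracial on the generated von Neumann algebra. -/
theorem map_mul_comm_of_words (hφ : IsUltraweak φ) (hT : ∀ t, IsSelfAdjoint (T t))
    (h : ∀ v w : List κ, φ ((v.map T).prod * (w.map T).prod) = φ ((w.map T).prod * (v.map T).prod))
    {x y : H →L[ℂ] H} (hx : x ∈ generatedVN (Set.range T)) (hy : y ∈ generatedVN (Set.range T)) :
    φ (x * y) = φ (y * x) := by
  have h1 : ∀ a ∈ StarAlgebra.adjoin ℂ (Set.range T), ∀ w : List κ,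
      φ (a * (w.map T).prod) = φ ((w.map T).prod * a) := by
    intro a ha w
    have hsp := mem_span_words hT ha
    clear ha
    induction hsp using Submodule.span_induction with
    | mem a ha => obtain ⟨v, rfl⟩ := ha; exact h v w
    | zero => simp
    | add a b _ _ iha ihb => rw [add_mul, mul_add, map_add, map_add, iha, ihb]
    | smul c a _ iha => rw [smul_mul_assoc, mul_smul_comm, map_smul, map_smul, iha]
  have h2 : ∀ a ∈ StarAlgebra.adjoin ℂ (Set.range T), ∀ b ∈ StarAlgebra.adjoin ℂ (Set.range T),
      φ (a * b) = φ (b * a) := by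
    intro a ha b hb
    have hsp := mem_span_words hT hb
    clear hb
    induction hsp using Submodule.span_induction with
    | mem b hb => obtain ⟨v, rfl⟩ := hb; exact h1 a ha v
    | zero => simp
    | add b c _ _ ihb ihc => rw [add_mul, mul_add, map_add, map_add, ihb, ihc]
    | smul c b _ ihb => rw [smul_mul_assoc, mul_smul_comm, map_smul, map_smul, ihb]
  -- The variables are extended to the von Neumann algebra one at a time, since multiplication by a
  -- fixed operator preserves ultraweak continuity.
  have h3 : ∀ a ∈ StarAlgebra.adjoin ℂ (Set.range T), φ (x * a) = φ (a * x) := fun a ha =>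
    sub_eq_zero.1 <| ((hφ.comp_mul_right a).sub (hφ.comp_mul_left a)).eq_zero_of_mem_generatedVN
      (fun b hb => sub_eq_zero.2 (h2 b hb a ha)) hx
  exact sub_eq_zero.1 <| ((hφ.comp_mul_left x).sub
    (hφ.comp_mul_right x)).eq_zero_of_mem_generatedVN (fun b hb => sub_eq_zero.2 (h3 b hb)) hy

/-- A functional whose moments on self-adjoint generators are semicircular is tracial. -/
theorem map_mul_comm_of_semicircularMoment {K : κ → κ → ℝ} (hK : ∀ i j, K i j = K j i)
    (hφ : IsUltraweak φ) (hT : ∀ t, IsSelfAdjoint (T t))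
    (h : ∀ w : List κ, φ (w.map T).prod = (semicircularMoment K w : ℂ))
    {x y : H →L[ℂ] H} (hx : x ∈ generatedVN (Set.range T)) (hy : y ∈ generatedVN (Set.range T)) :
    φ (x * y) = φ (y * x) :=
  map_mul_comm_of_words hφ hT (fun v w => by
    rw [← List.prod_append, ← List.prod_append, ← List.map_append, ← List.map_append, h, h,
      semicircularMoment_append_comm hK]) hx hy

end Functionals

/-! ### Increments of a free Brownian motion -/

section Increments

/-- The covariance of `i` and the Brownian motion at time `t`, where `i` is a time or, as `inl ()`,
the increment over `[n, n + 1]`. -/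
noncomputable def incrementCovAux (n : ℝ≥0) : Unit ⊕ ℝ≥0 → ℝ≥0 → ℝ
  | .inl _, t => (min (n + 1) t : ℝ≥0) - (min n t : ℝ≥0)
  | .inr s, t => (min s t : ℝ≥0)

/-- The covariance of a Brownian motion and its increment over `[n, n + 1]`, the latter represented
by the letter `inl ()`. -/
noncomputable def incrementCov (n : ℝ≥0) (i : Unit ⊕ ℝ≥0) : Unit ⊕ ℝ≥0 → ℝ
  | .inl _ => incrementCovAux n i (n + 1) - incrementCovAux n i n
  | .inr t => incrementCovAux n i t

/-- The covariance of a Brownian motion and an independent increment of length one. -/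
noncomputable def indepCov : Unit ⊕ ℝ≥0 → Unit ⊕ ℝ≥0 → ℝ
  | .inl _, .inl _ => 1
  | .inl _, .inr _ => 0
  | .inr _, .inl _ => 0
  | .inr s, .inr t => (min s t : ℝ≥0)

/-- For `t ≤ n` both `min (n + 1) t` and `min n t` equal `t`, so the increment is orthogonal to
everything up to time `n`; its variance is `1` for every `n`. -/
theorem incrementCov_eq_indepCov {n : ℝ≥0} {i j : Unit ⊕ ℝ≥0} (hi : ∀ t, i = .inr t → t ≤ n)
    (hj : ∀ t, j = .inr t → t ≤ n) : incrementCov n i j = indepCov i j := by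
  have hn : n ≤ n + 1 := le_self_add
  cases i with
  | inl _ =>
    cases j with
    | inl _ => simp [incrementCov, incrementCovAux, indepCov]
    | inr t =>
      have ht := hj t rfl
      simp [incrementCov, incrementCovAux, indepCov, ht, ht.trans hn]
  | inr s =>
    have hs := hi s rfl
    cases j with
    | inl _ => simp [incrementCov, incrementCovAux, indepCov, hs, hs.trans hn]
    | inr t => simp [incrementCov, incrementCovAux, indepCov]

variable {H : Type u} [NormedAddCommGroup H] [InnerProductSpace ℂ H]
  {φ : (H →L[ℂ] H) →ₗ[ℂ] ℂ} {T : ℝ≥0 → H →L[ℂ] H}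

/-- The family consisting of `T` and its increment over `[n, n + 1]`. -/
noncomputable def withIncrement (T : ℝ≥0 → H →L[ℂ] H) (n : ℝ≥0) : Unit ⊕ ℝ≥0 → H →L[ℂ] H
  | .inl _ => T (n + 1) - T n
  | .inr t => T t

theorem prod_map_withIncrement_inr (n : ℝ≥0) (w : List ℝ≥0) :
    ((w.map Sum.inr).map (withIncrement T n)).prod = (w.map T).prod := by
  rw [List.map_map]; rfl

/-- Both sides are linear in each letter, so an increment letter expands into two time letters. The
prefix `u` holds the letters already expanded. -/
theorem map_prod_withIncrement
    (h : ∀ w : List ℝ≥0,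
      φ (w.map T).prod = (semicircularMoment (fun s t => ((min s t : ℝ≥0) : ℝ)) w : ℂ))
    (n : ℝ≥0) (u : List ℝ≥0) (v : List (Unit ⊕ ℝ≥0)) :
    φ ((u.map Sum.inr ++ v).map (withIncrement T n)).prod =
      (semicircularMoment (incrementCov n) (u.map Sum.inr ++ v) : ℂ) := by
  induction v generalizing u with
  | nil =>
    rw [List.append_nil, prod_map_withIncrement_inr, h, semicircularMoment_map]
    rfl
  | cons i v ih =>
    cases i with
    | inr t => simpa [List.append_assoc] using ih (u ++ [t])
    | inl _ =>
      have h1 := ih (u ++ [n + 1])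
      have h2 := ih (u ++ [n])
      rw [List.map_append (l₁ := u), List.append_assoc, List.map_singleton,
        List.singleton_append] at h1 h2
      rw [semicircularMoment_sub (y := .inr (n + 1)) (z := .inr n) (fun i => by
          cases i with
          | inl _ => simp only [incrementCov, incrementCovAux]; ring
          | inr t => rfl)
        (fun i => rfl), Complex.ofReal_sub, ← h1, ← h2, ← map_sub]
      congr 1
      simp only [List.map_append, List.map_cons, List.prod_append, List.prod_cons]
      rw [← mul_sub, ← sub_mul]
      rfl

theorem map_prod_withIncrement_of_le
    (h : ∀ w : List ℝ≥0,
      φ (w.map T).prod = (semicircularMoment (fun s t => ((min s t : ℝ≥0) : ℝ)) w : ℂ))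
    {n : ℝ≥0} {w : List (Unit ⊕ ℝ≥0)} (hw : ∀ t, .inr t ∈ w → t ≤ n) :
    φ (w.map (withIncrement T n)).prod = (semicircularMoment indepCov w : ℂ) := by
  rw [semicircularMoment_congr (K' := incrementCov n)]
  · exact map_prod_withIncrement h n [] w
  · intro i hi j hj
    exact (incrementCov_eq_indepCov (fun t ht => hw t (ht ▸ hi)) (fun t ht => hw t (ht ▸ hj))).symm

/-- This is the one instance of freeness that is needed: the two increments form a block, and
noncrossing pairings cannot link the enclosed `p` with `q`. -/
theorem map_increment_mul
    (h : ∀ w : List ℝ≥0,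
      φ (w.map T).prod = (semicircularMoment (fun s t => ((min s t : ℝ≥0) : ℝ)) w : ℂ))
    {n : ℝ≥0} {p q : List ℝ≥0} (hp : ∀ t ∈ p, t ≤ n) (hq : ∀ t ∈ q, t ≤ n) :
    φ ((T (n + 1) - T n) * (p.map T).prod * (T (n + 1) - T n) * (q.map T).prod) =
      φ (p.map T).prod * φ (q.map T).prod := by
  have h1 := map_prod_withIncrement_of_le h (n := n)
    (w := .inl () :: (p.map Sum.inr ++ .inl () :: q.map Sum.inr)) (by
      intro t ht
      simp only [List.mem_cons, reduceCtorEq, List.mem_append, List.mem_map, Sum.inr.injEq,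
        exists_eq_right, false_or] at ht
      exact ht.elim (hp t) (hq t))
  rw [semicircularMoment_cons_append_cons rfl
    (by simp [indepCov]) (by simp [indepCov]), semicircularMoment_map, semicircularMoment_map,
    Complex.ofReal_mul] at h1
  rw [h p, h q]
  refine Eq.trans ?_ h1
  simp only [List.map_append, List.map_cons, List.prod_append, List.prod_cons,
    prod_map_withIncrement_inr, mul_assoc]
  rfl

end Increments

/-! ### Factoriality of the von Neumann algebra of a free Brownian motion -/

section Factor

variable {H : Type u} [NormedAddCommGroup H] [InnerProductSpace ℂ H] [CompleteSpace H]
  {φ : (H →L[ℂ] H) →ₗ[ℂ] ℂ} {T : ℝ≥0 → H →L[ℂ] H}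

/-- For `p` a word, `X p X - X X p` where `X` is the increment of `T` over `[n, n + 1]`. -/
noncomputable def incrementCommutator (T : ℝ≥0 → H →L[ℂ] H) (n : ℝ≥0) (p : List ℝ≥0) : H →L[ℂ] H :=
  (T (n + 1) - T n) * (p.map T).prod * (T (n + 1) - T n) -
    (T (n + 1) - T n) * (T (n + 1) - T n) * (p.map T).prod

theorem eventually_forall_mem_le (p : List ℝ≥0) : ∀ᶠ n : ℝ≥0 in Filter.atTop, ∀ t ∈ p, t ≤ n :=
  (Filter.eventually_all_finite p.finite_toSet).2 fun t _ => Filter.eventually_ge_atTop t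

/-- How large `n` must be depends on `a`, through the finitely many words in it. -/
theorem map_incrementCommutator_mul
    (h : ∀ w : List ℝ≥0,
      φ (w.map T).prod = (semicircularMoment (fun s t => ((min s t : ℝ≥0) : ℝ)) w : ℂ))
    (hT : ∀ t, IsSelfAdjoint (T t)) (p : List ℝ≥0) {a : H →L[ℂ] H}
    (ha : a ∈ StarAlgebra.adjoin ℂ (Set.range T)) :
    ∀ᶠ n : ℝ≥0 in Filter.atTop, φ (incrementCommutator T n p * a) =
      φ (p.map T).prod * φ a - φ ((p.map T).prod * a) := by
  have hsp := mem_span_words hT ha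
  clear ha
  induction hsp using Submodule.span_induction with
  | mem a ha =>
    obtain ⟨q, rfl⟩ := ha
    filter_upwards [eventually_forall_mem_le p, eventually_forall_mem_le q] with n hp hq
    have e1 := map_increment_mul h hp hq
    -- The empty word between the increments turns `X X P` into the same pattern.
    have e2 := map_increment_mul h (p := []) (q := p ++ q) (by simp) (n := n) (by
      intro t ht
      exact (List.mem_append.1 ht).elim (hp t) (hq t))
    have e3 : φ ((([] : List ℝ≥0).map T).prod) = 1 := by
      rw [h]; simp
    rw [e3, one_mul, List.map_nil, List.prod_nil, mul_one, List.map_append, List.prod_append] at e2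
    rw [incrementCommutator, sub_mul, map_sub, e1, ← e2]
    simp only [mul_assoc]
  | zero => simp
  | add a b _ _ iha ihb =>
    filter_upwards [iha, ihb] with n ha hb
    rw [mul_add, mul_add, map_add, map_add, map_add, ha, hb]
    ring
  | smul c a _ iha =>
    filter_upwards [iha] with n ha
    rw [mul_smul_comm, mul_smul_comm, map_smul, map_smul, map_smul, ha]
    simp only [smul_eq_mul]
    ring

/-- The commutators with late increments are bounded in the `L²` norm. -/
theorem exists_map_incrementCommutator_mul_star_eq
    (h : ∀ w : List ℝ≥0,
      φ (w.map T).prod = (semicircularMoment (fun s t => ((min s t : ℝ≥0) : ℝ)) w : ℂ))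
    (hT : ∀ t, IsSelfAdjoint (T t)) (p : List ℝ≥0) :
    ∃ C : ℂ, ∀ᶠ n : ℝ≥0 in Filter.atTop,
      φ (incrementCommutator T n p * star (incrementCommutator T n p)) = C := by
  let x : List (Unit ⊕ ℝ≥0) := [.inl ()]
  let a : List (Unit ⊕ ℝ≥0) := p.map .inr
  let b : List (Unit ⊕ ℝ≥0) := p.reverse.map .inr
  let m : List (Unit ⊕ ℝ≥0) → ℂ := fun w => (semicircularMoment indepCov w : ℂ)
  -- Here `C` is the four-term expansion of `W W*`, evaluated with the covariance `indepCov`, which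
  -- does not involve `n`.
  refine ⟨m (x ++ a ++ x ++ (x ++ b ++ x)) - m (x ++ x ++ a ++ (x ++ b ++ x)) -
    (m (x ++ a ++ x ++ (b ++ x ++ x)) - m (x ++ x ++ a ++ (b ++ x ++ x))), ?_⟩
  filter_upwards [eventually_forall_mem_le p] with n hp
  have key : ∀ w : List (Unit ⊕ ℝ≥0), (∀ t, .inr t ∈ w → t ∈ p) →
      φ (w.map (withIncrement T n)).prod = m w := fun w hw =>
    map_prod_withIncrement_of_le h fun t ht => hp t (hw t ht)
  have hx : (x.map (withIncrement T n)).prod = T (n + 1) - T n := by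
    simp [x, withIncrement]
  have hX : IsSelfAdjoint (T (n + 1) - T n) := (hT _).sub (hT _)
  have ha : (a.map (withIncrement T n)).prod = (p.map T).prod := prod_map_withIncrement_inr n p
  have hb : (b.map (withIncrement T n)).prod = (p.reverse.map T).prod :=
    prod_map_withIncrement_inr n p.reverse
  rw [← key _ (by simp [x, a, b]), ← key _ (by simp [x, a, b]), ← key _ (by simp [x, a, b]),
    ← key _ (by simp [x, a, b])]
  simp only [List.map_append, List.prod_append, hx, ha, hb]
  rw [← map_sub, ← map_sub, ← map_sub, ← sub_mul, ← sub_mul, ← mul_sub, incrementCommutator,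
    star_sub, star_mul, star_mul, star_mul, star_mul, hX.star_eq, star_prod_map hT]
  simp only [mul_assoc]

/-- The proof compares `z` with a polynomial `a` through three Cauchy-Schwarz estimates, tested
against `P`, `W` and `1`. -/
theorem map_mul_eq_of_mem_center (hφ : IsUltraweak φ)
    (hnn : ∀ x ∈ generatedVN (Set.range T), 0 ≤ φ (star x * x))
    (hT : ∀ t, IsSelfAdjoint (T t))
    (h : ∀ w : List ℝ≥0,
      φ (w.map T).prod = (semicircularMoment (fun s t => ((min s t : ℝ≥0) : ℝ)) w : ℂ))
    {z : H →L[ℂ] H} (hz : z ∈ generatedVN (Set.range T))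
    (hz' : z ∈ (generatedVN (Set.range T)).commutant) (p : List ℝ≥0) :
    φ ((p.map T).prod * z) = φ (p.map T).prod * φ z := by
  set N := generatedVN (Set.range T) with hN
  set P := (p.map T).prod with hP
  have hA : ∀ a ∈ StarAlgebra.adjoin ℂ (Set.range T), a ∈ N := fun a ha =>
    adjoin_le_generatedVN _ ha
  have hTN : ∀ t, T t ∈ N := fun t => hA _ (StarAlgebra.subset_adjoin ℂ _ ⟨t, rfl⟩)
  have hPN : P ∈ N := hA _ (prod_map_mem_adjoin p)
  have hWN : ∀ n, incrementCommutator T n p ∈ N := fun n =>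
    have hX : T (n + 1) - T n ∈ N := sub_mem (hTN _) (hTN _)
    sub_mem (mul_mem (mul_mem hX hPN) hX) (mul_mem (mul_mem hX hX) hPN)
  -- Centrality and the trace property give `φ (X P X z) = φ (X P z X) = φ (X X P z)`.
  have hWz : ∀ n, φ (incrementCommutator T n p * z) = 0 := by
    intro n
    have hX : T (n + 1) - T n ∈ N := sub_mem (hTN _) (hTN _)
    have hcomm : (T (n + 1) - T n) * z = z * (T (n + 1) - T n) :=
      VonNeumannAlgebra.mem_commutant_iff.1 hz' _ hX
    have htr := map_mul_comm_of_semicircularMoment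
      (fun s t => by rw [min_comm]) hφ hT h (mul_mem (mul_mem hX hPN) hz) hX
    rw [incrementCommutator, ← hP, sub_mul, map_sub, sub_eq_zero, mul_assoc _ _ z, hcomm,
      ← mul_assoc, htr]
    simp only [mul_assoc]
  obtain ⟨C, hC⟩ := exists_map_incrementCommutator_mul_star_eq h hT p
  -- The index `n` is chosen after `a`, hence after `δ`; the estimate survives because `C` does not
  -- depend on `n`.
  have hbound : ∀ δ : ℝ, 0 < δ → ‖φ (P * z) - φ P * φ z‖ ≤
      (√‖φ (P * star P)‖ + √‖C‖ + ‖φ P‖ * √‖φ (1 * star 1)‖) * δ := by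
    intro δ hδ
    obtain ⟨a, ha, haz⟩ := hφ.exists_adjoin_approx hz hδ
    obtain ⟨n, hn, hCn⟩ := ((map_incrementCommutator_mul h hT p ha).and hC).exists
    have hy : z - a ∈ N := sub_mem hz (hA a ha)
    have hle : √‖φ (star (z - a) * (z - a))‖ ≤ δ := Real.sqrt_le_left (by positivity) |>.2 haz.le
    have cs : ∀ x ∈ N, ‖φ (x * (z - a))‖ ≤ √‖φ (x * star x)‖ * δ := fun x hx =>
      (norm_map_mul_le hnn hx hy).trans (by gcongr)
    have c1 := cs P hPN
    have c2 := cs _ (hWN n)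
    have c3 := cs 1 (one_mem N)
    rw [hCn, mul_sub, map_sub, hWz, hn] at c2
    rw [one_mul] at c3
    -- The middle term is `φ (W (z - a))`, the leading `0` being `φ (W z)`.
    have e : φ (P * z) - φ P * φ z =
        φ (P * (z - a)) + (0 - (φ P * φ a - φ (P * a))) - φ P * φ (z - a) := by
      rw [mul_sub, map_sub, map_sub]
      ring
    rw [e]
    refine (norm_sub_le _ _).trans ?_
    have := norm_add_le (φ (P * (z - a))) (0 - (φ P * φ a - φ (P * a)))
    have c4 : ‖φ P * φ (z - a)‖ ≤ ‖φ P‖ * (√‖φ (1 * star 1)‖ * δ) := by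
      rw [norm_mul]
      gcongr
    linarith
  refine sub_eq_zero.1 (norm_le_zero_iff.1 ?_)
  set c := √‖φ (P * star P)‖ + √‖C‖ + ‖φ P‖ * √‖φ (1 * star 1)‖ with hc
  have hc0 : 0 ≤ c := by positivity
  refine le_of_forall_pos_le_add fun ε hε => ?_
  rw [zero_add]
  -- The denominator is `c + 1` because `c` may vanish.
  refine (hbound (ε / (c + 1)) (by positivity)).trans ?_
  rw [mul_div_assoc', div_le_iff₀ (by positivity)]
  nlinarith

theorem isFactor_of_semicircularMoment (hφ : IsUltraweak φ)
    (hnn : ∀ x ∈ generatedVN (Set.range T), 0 ≤ φ (star x * x))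
    (hfaith : ∀ x ∈ generatedVN (Set.range T), φ (star x * x) = 0 → x = 0)
    (hT : ∀ t, IsSelfAdjoint (T t))
    (h : ∀ w : List ℝ≥0,
      φ (w.map T).prod = (semicircularMoment (fun s t => ((min s t : ℝ≥0) : ℝ)) w : ℂ)) :
    IsFactor (generatedVN (Set.range T)) := by
  refine Set.Subset.antisymm ?_ ?_
  · rintro z ⟨hz, hz'⟩
    have h1 : ∀ a ∈ StarAlgebra.adjoin ℂ (Set.range T), φ (a * z) = φ a * φ z := by
      intro a ha
      have hsp := mem_span_words hT ha
      clear ha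
      induction hsp using Submodule.span_induction with
      | mem a ha => obtain ⟨p, rfl⟩ := ha; exact map_mul_eq_of_mem_center hφ hnn hT h hz hz' p
      | zero => simp
      | add a b _ _ iha ihb => rw [add_mul, map_add, map_add, iha, ihb, add_mul]
      | smul c a _ iha =>
        rw [smul_mul_assoc, map_smul, map_smul, iha, smul_eq_mul, smul_eq_mul, mul_assoc]
    have h2 : φ (star z * z) = φ (star z) * φ z :=
      sub_eq_zero.1 <| ((hφ.comp_mul_right z).sub (hφ.mul_const (φ z))).eq_zero_of_mem_generatedVN
        (fun a ha => sub_eq_zero.2 (h1 a ha)) (star_mem hz)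
    have hone : φ 1 = 1 := by simpa using h []
    have hsc : algebraMap ℂ (H →L[ℂ] H) (φ z) ∈ generatedVN (Set.range T) :=
      (generatedVN (Set.range T)).toStarSubalgebra.algebraMap_mem _
    -- With `h2`, the element `z - φ z` has second moment `φ (z* z) - φ (z*) φ z = 0`.
    refine ⟨φ z, (sub_eq_zero.1 (hfaith (z - algebraMap ℂ _ (φ z)) (sub_mem hz hsc) ?_)).symm⟩
    rw [Algebra.algebraMap_eq_smul_one, star_sub, star_smul, star_one, sub_mul, mul_sub, mul_sub,
      smul_mul_assoc, smul_mul_assoc, one_mul, one_mul, mul_smul_comm, mul_one, map_sub, map_sub,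
      map_sub, map_smul, map_smul, map_smul, map_smul, h2, hone]
    simp only [smul_eq_mul]
    ring
  · rintro _ ⟨c, rfl⟩
    exact ⟨(generatedVN (Set.range T)).toStarSubalgebra.algebraMap_mem c,
      (generatedVN (Set.range T)).commutant.toStarSubalgebra.algebraMap_mem c⟩

/-- A normal functional on a von Neumann algebra is the restriction of an ultraweakly continuous
functional on `B(H)`. -/
theorem IsFaithfulNormalState.exists_isUltraweak {M : VonNeumannAlgebra H}
    {τ : M.toStarSubalgebra →ₗ[ℂ] ℂ} (hτ : IsFaithfulNormalState M τ) :
    ∃ φ : (H →L[ℂ] H) →ₗ[ℂ] ℂ, IsUltraweak φ ∧ ∀ x : M.toStarSubalgebra, φ x = τ x := by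
  obtain ⟨ξ, η, hξ, hη, h⟩ := hτ.normal
  let ξ' : HilbertMultiple H ℕ := ⟨ξ, memℓp_two_of_summable hξ⟩
  let η' : HilbertMultiple H ℕ := ⟨η, memℓp_two_of_summable hη⟩
  refine ⟨(innerSL ℂ η').toLinearMap ∘ₗ amplifyEval ξ', ⟨ℕ, ξ', η', fun _ => rfl⟩, fun x => ?_⟩
  rw [h]
  exact lp.inner_eq_tsum (𝕜 := ℂ) η' (amplify ℕ x ξ')

theorem generatedVN_le {M : VonNeumannAlgebra H} {s : Set (H →L[ℂ] H)} (hs : ∀ x ∈ s, x ∈ M)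
    {x : H →L[ℂ] H} (hx : x ∈ generatedVN s) : x ∈ M := by
  rw [← VonNeumannAlgebra.commutant_commutant M, VonNeumannAlgebra.mem_commutant_iff]
  intro y hy
  rw [VonNeumannAlgebra.mem_commutant_iff] at hy
  refine mem_generatedVN_iff.1 hx y ((StarSubalgebra.mem_centralizer_iff ℂ).2 fun g hg => ?_)
  exact ⟨hy g (hs g hg), hy _ (star_mem (hs g hg))⟩

/-- The von Neumann algebra generated by a free Brownian motion is a factor. -/
theorem IsFreeBrownianMotion.isFactor {M : VonNeumannAlgebra H} {τ : M.toStarSubalgebra →ₗ[ℂ] ℂ}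
    {S : ℝ≥0 → M.toStarSubalgebra} (hτ : IsFaithfulNormalState M τ)
    (hS : IsFreeBrownianMotion M τ S) :
    IsFactor (generatedVN (Set.range fun t => (S t : H →L[ℂ] H))) := by
  obtain ⟨φ, hφ, hφτ⟩ := hτ.exists_isUltraweak
  have hM : ∀ x ∈ generatedVN (Set.range fun t => (S t : H →L[ℂ] H)), x ∈ M := fun x hx =>
    generatedVN_le (by rintro _ ⟨t, rfl⟩; exact (S t).2) hx
  refine isFactor_of_semicircularMoment hφ (fun x hx => ?_) (fun x hx h0 => ?_) (fun t => ?_)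
    (fun w => ?_)
  · exact (hτ.nonneg ⟨x, hM x hx⟩).trans_eq (hφτ _).symm
  · exact congrArg Subtype.val (hτ.faithful ⟨x, hM x hx⟩ ((hφτ _).symm.trans h0))
  · exact congrArg Subtype.val (hS.selfAdjoint t)
  · rw [← hS.moments w, ← hφτ]
    congr 1
    have := map_list_prod M.toStarSubalgebra.subtype (w.map S)
    rw [List.map_map] at this
    exact this.symm

end Factor

/-! ### Vector states -/

section VectorState

variable {H : Type u} [NormedAddCommGroup H] [InnerProductSpace ℂ H]

/-- The functional `x ↦ ⟪Ω, x Ω⟫`. -/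
noncomputable def vectorFunctional (Ω : H) : (H →L[ℂ] H) →ₗ[ℂ] ℂ where
  toFun x := ⟪Ω, x Ω⟫_ℂ
  map_add' _ _ := inner_add_right _ _ _
  map_smul' _ _ := inner_smul_right _ _ _

theorem isUltraweak_vectorFunctional (Ω : H) : IsUltraweak (vectorFunctional Ω) := by
  refine ⟨Unit, lp.single 2 () Ω, lp.single 2 () Ω, fun x => ?_⟩
  rw [amplify_single, lp.inner_single_left, lp.single_apply_self]
  rfl

variable [CompleteSpace H]

theorem vectorFunctional_star_mul (Ω : H) (x y : H →L[ℂ] H) :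
    vectorFunctional Ω (star x * y) = ⟪x Ω, y Ω⟫_ℂ :=
  ContinuousLinearMap.adjoint_inner_right x Ω (y Ω)

/-- A cyclic vector with a tracial vector state is separating. -/
theorem eq_zero_of_cyclic_of_tracial {N : VonNeumannAlgebra H} {Ω : H} {D : Set H}
    (hD : Dense D) (hDN : ∀ v ∈ D, ∃ y ∈ N, y Ω = v)
    (htr : ∀ x ∈ N, ∀ y ∈ N, vectorFunctional Ω (x * y) = vectorFunctional Ω (y * x))
    {x : H →L[ℂ] H} (hx : x ∈ N) (h0 : vectorFunctional Ω (star x * x) = 0) : x = 0 := by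
  -- By traciality `‖x* Ω‖² = φ (x x*) = φ (x* x) = 0`; likewise `‖x y Ω‖ = ‖y* x* Ω‖` below.
  have hx0 : star x Ω = 0 := by
    rw [htr _ (star_mem hx) _ hx] at h0
    have := vectorFunctional_star_mul Ω (star x) (star x)
    rw [star_star, h0] at this
    exact inner_self_eq_zero.1 this.symm
  have hker : ∀ v ∈ D, x v = 0 := by
    intro v hv
    obtain ⟨y, hy, rfl⟩ := hDN v hv
    have h1 := vectorFunctional_star_mul Ω (x * y) (x * y)
    have h2 := vectorFunctional_star_mul Ω (star y * star x) (star y * star x)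
    rw [htr _ (star_mem (mul_mem hx hy)) _ (mul_mem hx hy)] at h1
    rw [← star_mul, star_star, h1] at h2
    have h3 : star (x * y) Ω = 0 := by
      rw [star_mul, mul_apply_eq_comp, hx0, map_zero]
    rw [h3, inner_zero_left] at h2
    exact inner_self_eq_zero.1 h2
  ext v
  exact congrFun (x.continuous.ext_on hD continuous_const hker) v

/-- A Brownian motion with a cyclic vector implementing its moments generates a factor. -/
theorem isFactor_of_cyclic {Ω : H} {T : ℝ≥0 → H →L[ℂ] H} (hT : ∀ t, IsSelfAdjoint (T t))
    (h : ∀ w : List ℝ≥0,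
      ⟪Ω, (w.map T).prod Ω⟫_ℂ = (semicircularMoment (fun s t => ((min s t : ℝ≥0) : ℝ)) w : ℂ))
    (hΩ : Dense (Submodule.span ℂ (Set.range fun w : List ℝ≥0 => (w.map T).prod Ω) : Set H)) :
    IsFactor (generatedVN (Set.range T)) := by
  refine isFactor_of_semicircularMoment (isUltraweak_vectorFunctional Ω) (fun x _ => ?_)
    (fun x hx h0 => ?_) hT h
  · rw [vectorFunctional_star_mul, inner_self_eq_norm_sq_to_K]
    exact Complex.zero_le_real.2 (sq_nonneg ‖x Ω‖) |>.trans_eq (Complex.ofReal_pow _ _)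
  · refine eq_zero_of_cyclic_of_tracial hΩ (fun v hv => ?_) (fun x hx y hy =>
      map_mul_comm_of_semicircularMoment (fun s t => by rw [min_comm])
        (isUltraweak_vectorFunctional Ω) hT h hx hy) hx h0
    have hv' : v ∈ (Subalgebra.toSubmodule
        (generatedVN (Set.range T)).toStarSubalgebra.toSubalgebra).map
        (ContinuousLinearMap.apply ℂ H Ω : (H →L[ℂ] H) →L[ℂ] H).toLinearMap := by
      refine Submodule.span_le.2 ?_ hv
      rintro _ ⟨w, rfl⟩
      exact ⟨(w.map T).prod, adjoin_le_generatedVN _ (prod_map_mem_adjoin w), rfl⟩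
    exact hv'

end VectorState

/-! ### Creation and annihilation on the free Fock space -/

namespace FreeFock

variable {E : Type} [NormedAddCommGroup E] [InnerProductSpace ℂ E]

theorem inner_tensorCons (g h : E) (n : ℕ) (x y : TensorPow E n) :
    ⟪tensorCons g n x, tensorCons h n y⟫_ℂ = ⟪g, h⟫_ℂ * ⟪x, y⟫_ℂ :=
  TensorProduct.inner_tmul (𝕜 := ℂ) (F := (tensorPowAux E n).carrier) g h x y

theorem inner_completion_tensorCons (g h : E) (n : ℕ) (x y : Completion (TensorPow E n)) :
    ⟪(tensorCons g n).completion x, (tensorCons h n).completion y⟫_ℂ = ⟪g, h⟫_ℂ * ⟪x, y⟫_ℂ := by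
  induction x, y using Completion.induction_on₂ with
  | hp =>
    exact isClosed_eq
      (((tensorCons g n).completion.continuous.comp continuous_fst).inner
        ((tensorCons h n).completion.continuous.comp continuous_snd))
      (continuous_const.mul (continuous_fst.inner continuous_snd))
  | ih x y =>
    rw [ContinuousLinearMap.completion_apply_coe, ContinuousLinearMap.completion_apply_coe,
      Completion.inner_coe, Completion.inner_coe, inner_tensorCons]

theorem leftCreation_apply_zero (h : E) (f : Fock E) : leftCreation h f 0 = 0 := rfl

theorem leftCreation_apply_succ (h : E) (f : Fock E) (n : ℕ) :
    leftCreation h f (n + 1) = (tensorCons h n).completion (f n) := rfl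

theorem inner_leftCreation (g h : E) (x y : Fock E) :
    ⟪leftCreation g x, leftCreation h y⟫_ℂ = ⟪g, h⟫_ℂ * ⟪x, y⟫_ℂ := by
  have h0 := (lp.summable_inner (𝕜 := ℂ) (leftCreation g x) (leftCreation h y)).tsum_eq_zero_add
  rw [leftCreation_apply_zero, inner_zero_left, zero_add] at h0
  rw [lp.inner_eq_tsum, h0, lp.inner_eq_tsum, ← tsum_mul_left]
  exact tsum_congr fun n => inner_completion_tensorCons g h n (x n) (y n)

theorem leftAnnihilation_leftCreation (g h : E) (x : Fock E) :
    leftAnnihilation g (leftCreation h x) = ⟪g, h⟫_ℂ • x := by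
  refine ext_inner_left ℂ fun y => ?_
  rw [leftAnnihilation, ContinuousLinearMap.adjoint_inner_right, inner_leftCreation,
    inner_smul_right]

theorem leftAnnihilation_vacuum (h : E) : leftAnnihilation h (vacuum E) = 0 := by
  refine ext_inner_left ℂ fun y => ?_
  rw [leftAnnihilation, ContinuousLinearMap.adjoint_inner_right, vacuum, lp.inner_single_right,
    leftCreation_apply_zero, inner_zero_left, inner_zero_right]

theorem inner_vacuum_vacuum : ⟪vacuum E, vacuum E⟫_ℂ = 1 := by
  rw [vacuum, lp.inner_single_right, lp.single_apply_self, Completion.inner_coe]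
  exact (RCLike.inner_apply (1 : ℂ) (1 : ℂ)).trans (by simp)

theorem leftCreation_add (g h : E) : leftCreation (g + h) = leftCreation g + leftCreation h := by
  ext x n
  cases n with
  | zero => exact (add_zero (0 : Completion (TensorPow E 0))).symm
  | succ n =>
    change (tensorCons (g + h) n).completion (x n) =
      (tensorCons g n).completion (x n) + (tensorCons h n).completion (x n)
    induction x n using Completion.induction_on with
    | hp =>
      exact isClosed_eq (tensorCons _ n).completion.continuous ((tensorCons g n).completion.continuous.add (tensorCons h n).completion.continuous)
    | ih y =>
      simp only [ContinuousLinearMap.completion_apply_coe]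
      rw [← Completion.coe_add]
      exact congrArg _ (TensorProduct.add_tmul g h (y : (tensorPowAux E n).carrier))

theorem leftCreation_smul (c : ℂ) (h : E) : leftCreation (c • h) = c • leftCreation h := by
  ext x n
  cases n with
  | zero => exact (smul_zero (A := Completion (TensorPow E 0)) c).symm
  | succ n =>
    change (tensorCons (c • h) n).completion (x n) = c • (tensorCons h n).completion (x n)
    induction x n using Completion.induction_on with
    | hp =>
      exact isClosed_eq (tensorCons _ n).completion.continuous ((tensorCons h n).completion.continuous.const_smul c)
    | ih y =>
      simp only [ContinuousLinearMap.completion_apply_coe]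
      rw [← Completion.coe_smul]
      exact congrArg _ (TensorProduct.smul_tmul' c h (y : (tensorPowAux E n).carrier)).symm

/-- The left creation operator as a bounded linear function of its vector. -/
noncomputable def leftCreationCLM : E →L[ℂ] Fock E →L[ℂ] Fock E :=
  LinearMap.mkContinuous
    { toFun := leftCreation
      map_add' := leftCreation_add
      map_smul' := leftCreation_smul } 1 fun h => by
    rw [one_mul]
    exact ContinuousLinearMap.opNorm_le_bound _ (norm_nonneg h) (norm_creationVec_le h)

theorem isSelfAdjoint_semicircular (h : E) : IsSelfAdjoint (semicircular h) := by
  rw [isSelfAdjoint_iff, semicircular, star_add, leftAnnihilation,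
    ← ContinuousLinearMap.star_eq_adjoint, star_star, add_comm]

/-! ### Vacuum moments of semicircular operators -/

section Moments

variable {ι : Type*} {f : ι → E} {K : ι → ι → ℝ}

/-- The action of an annihilation operator on a word in semicircular operators applied to the
vacuum. -/
theorem leftAnnihilation_prod_vacuum (hK : ∀ i j, ⟪f i, f j⟫_ℂ = (K i j : ℂ)) (h : E)
    (w : List ι) :
    leftAnnihilation h ((w.map fun i => semicircular (f i)).prod (vacuum E)) =
      splitSum (fun u x v => (⟪h, f x⟫_ℂ * (semicircularMoment K u : ℂ)) •
        (v.map fun i => semicircular (f i)).prod (vacuum E)) w := by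
  induction hn : w.length using Nat.strong_induction_on generalizing w h with
  | _ n ih =>
    cases w with
    | nil => exact leftAnnihilation_vacuum h
    | cons a w =>
      have hw : w.length < n := by rw [← hn]; simp
      -- Write `S = l + l*` for the first letter `a`. The `l` part is contracted with `l*(h)`,
      -- giving the head term. The `l*` part takes the induction hypothesis twice, first for `f a`
      -- and then for `h`, which is why `h` is generalized.
      rw [List.map_cons, List.prod_cons, mul_apply_eq_comp, splitSum_cons,
        semicircular, add_apply, map_add, leftAnnihilation_leftCreation,
        semicircularMoment_nil, Complex.ofReal_one, mul_one, ih _ hw (f a) w rfl]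
      congr 1
      have e1 := map_splitSum (leftAnnihilation h : Fock E →L[ℂ] Fock E).toLinearMap.toAddMonoidHom
        (fun u x v => (⟪f a, f x⟫_ℂ * (semicircularMoment K u : ℂ)) •
          (v.map fun i => semicircular (f i)).prod (vacuum E)) w
      refine Eq.trans e1 ?_
      have e2 : splitSum (fun u x v => leftAnnihilation h
            ((⟪f a, f x⟫_ℂ * (semicircularMoment K u : ℂ)) •
              (v.map fun i => semicircular (f i)).prod (vacuum E))) w =
          splitSum (fun u x v => splitSum (fun u' y v' =>
            (⟪h, f y⟫_ℂ * ((K a x * semicircularMoment K u * semicircularMoment K u' : ℝ) : ℂ)) •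
              (v'.map fun i => semicircular (f i)).prod (vacuum E)) v) w := by
        refine splitSum_congr fun u x v huv => ?_
        rw [map_smul, ih v.length (lt_of_le_of_lt (by rw [huv]; simp; omega) hw) h v rfl]
        refine (map_splitSum (DistribSMul.toAddMonoidHom (Fock E)
          (⟪f a, f x⟫_ℂ * (semicircularMoment K u : ℂ))) _ v).trans ?_
        refine splitSum_congr fun u' y v' _ => ?_
        rw [DistribSMul.toAddMonoidHom_apply, smul_smul, hK]
        congr 1
        push_cast
        ring
      refine Eq.trans e2 ?_
      rw [splitSum_comm]
      refine splitSum_congr fun p y v' _ => ?_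
      rw [semicircularMoment_cons]
      have e3 := map_splitSum ((LinearMap.toSpanSingleton ℂ (Fock E)
          ((v'.map fun i => semicircular (f i)).prod (vacuum E))).toAddMonoidHom.comp
          ((AddMonoidHom.mulLeft ⟪h, f y⟫_ℂ).comp Complex.ofRealHom.toAddMonoidHom))
        (fun u x u' => K a x * semicircularMoment K u * semicircularMoment K u') p
      exact e3.symm

/-- The vacuum moments of semicircular operators. -/
theorem inner_vacuum_prod_vacuum (hK : ∀ i j, ⟪f i, f j⟫_ℂ = (K i j : ℂ)) (w : List ι) :
    ⟪vacuum E, (w.map fun i => semicircular (f i)).prod (vacuum E)⟫_ℂ =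
      (semicircularMoment K w : ℂ) := by
  induction hn : w.length using Nat.strong_induction_on generalizing w with
  | _ n ih =>
    cases w with
    | nil =>
      rw [semicircularMoment_nil, Complex.ofReal_one]
      exact inner_vacuum_vacuum
    | cons a w =>
      have hw : w.length < n := by rw [← hn]; simp
      rw [List.map_cons, List.prod_cons, mul_apply_eq_comp, semicircular,
        add_apply, inner_add_right,
        ← ContinuousLinearMap.adjoint_inner_left (leftCreation (f a))]
      change ⟪leftAnnihilation (f a) (vacuum E), _⟫_ℂ + _ = _
      rw [leftAnnihilation_vacuum, inner_zero_left, zero_add, leftAnnihilation_prod_vacuum hK,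
        semicircularMoment_cons]
      refine (map_splitSum (innerSL ℂ (vacuum E)).toLinearMap.toAddMonoidHom _ w).trans ?_
      refine Eq.trans ?_ (map_splitSum Complex.ofRealHom.toAddMonoidHom _ w).symm
      refine splitSum_congr fun u x v huv => ?_
      change ⟪vacuum E, _ • _⟫_ℂ = ((_ : ℝ) : ℂ)
      rw [inner_smul_right, ih v.length (lt_of_le_of_lt (by rw [huv]; simp; omega) hw) v rfl, hK]
      push_cast
      rfl

end Moments

/-! ### Cyclicity of the vacuum -/

section Cyclic

variable {ι : Type*} {f : ι → E}

/-- Words in creation operators applied to the vacuum are linear combinations of words in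
semicircular operators applied to the vacuum. -/
theorem prod_leftCreation_vacuum_mem_span (w : List ι) :
    (w.map fun i => leftCreation (f i)).prod (vacuum E) ∈ Submodule.span ℂ
      (Set.range fun w : List ι => (w.map fun i => semicircular (f i)).prod (vacuum E)) := by
  set D := Submodule.span ℂ
    (Set.range fun w : List ι => (w.map fun i => semicircular (f i)).prod (vacuum E)) with hD
  have hinv : ∀ i, ∀ x ∈ D, semicircular (f i) x ∈ D := by
    intro i
    change D ≤ D.comap (semicircular (f i)).toLinearMap
    refine Submodule.span_le.2 ?_
    rintro _ ⟨w, rfl⟩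
    exact Submodule.subset_span ⟨i :: w, rfl⟩
  induction hn : w.length using Nat.strong_induction_on generalizing w with
  | _ n ih =>
    cases w with
    | nil => exact Submodule.subset_span ⟨[], rfl⟩
    | cons i w =>
      have hw : w.length < n := by rw [← hn]; simp
      -- Since `l = S - l*` and `l*` contracts with the next creation operator to a scalar, the
      -- correction is a multiple of a word two letters shorter.
      have e : ((i :: w).map fun i => leftCreation (f i)).prod (vacuum E) =
          semicircular (f i) ((w.map fun i => leftCreation (f i)).prod (vacuum E)) -
            leftAnnihilation (f i) ((w.map fun i => leftCreation (f i)).prod (vacuum E)) := by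
        rw [semicircular, add_apply, add_sub_cancel_right]
        rfl
      rw [e]
      refine sub_mem (hinv i _ (ih _ hw w rfl)) ?_
      cases w with
      | nil =>
        rw [List.map_nil, List.prod_nil, one_apply_eq_self, leftAnnihilation_vacuum]
        exact zero_mem D
      | cons j w =>
        rw [List.map_cons, List.prod_cons, mul_apply_eq_comp,
          leftAnnihilation_leftCreation]
        exact D.smul_mem _ (ih w.length ((Nat.lt_succ_self _).trans hw) w rfl)

theorem leftCreation_single (h : E) (n : ℕ) (x : Completion (TensorPow E n)) :
    leftCreation h (lp.single 2 n x) = lp.single 2 (n + 1) ((tensorCons h n).completion x) := by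
  ext m
  cases m with
  | zero => rw [leftCreation_apply_zero, lp.single_apply_ne _ _ _ (Nat.succ_ne_zero n).symm]
  | succ m =>
    rw [leftCreation_apply_succ]
    by_cases hm : m = n
    · subst hm
      rw [lp.single_apply_self, lp.single_apply_self]
    · rw [lp.single_apply_ne _ _ _ hm, lp.single_apply_ne _ _ _ (by omega), map_zero]

/-- A closed subspace of the Fock space that contains the vacuum and is invariant under all
creation operators is everything. -/
theorem eq_top_of_leftCreation_mem {D : Submodule ℂ (Fock E)} (hc : IsClosed (D : Set (Fock E)))
    (h0 : vacuum E ∈ D) (hinv : ∀ h, ∀ x ∈ D, leftCreation h x ∈ D) : D = ⊤ := by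
  have h1 : ∀ n (x : TensorPow E n), lp.single 2 n (x : Completion (TensorPow E n)) ∈ D := by
    intro n
    induction n with
    | zero =>
      intro x
      have e : x = (show ℂ from x) • unitTensor E := (mul_one (show ℂ from x)).symm
      rw [e, Completion.coe_smul, lp.single_smul]
      exact D.smul_mem _ h0
    | succ n ih =>
      intro x
      refine TensorProduct.induction_on (motive := fun y : E ⊗[ℂ] (tensorPowAux E n).carrier =>
        lp.single 2 (n + 1) (((show TensorPow E (n + 1) from y) :
          TensorPow E (n + 1)) : Completion (TensorPow E (n + 1))) ∈ D) x ?_ ?_ ?_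
      · change lp.single 2 (n + 1) (((0 : TensorPow E (n + 1))) : Completion _) ∈ D
        rw [Completion.coe_zero, lp.single_zero]
        exact D.zero_mem
      · intro h y
        have := hinv h _ (ih y)
        rw [leftCreation_single] at this
        have e := ContinuousLinearMap.completion_apply_coe (tensorCons h n)
          (show TensorPow E n from y)
        exact (congrArg (fun v => lp.single 2 (n + 1) v ∈ D) e).mp this
      · intro y z hy hz
        have := D.add_mem hy hz
        rw [← lp.single_add, ← Completion.coe_add] at this
        exact this
  have h2 : ∀ n (x : Completion (TensorPow E n)), lp.single 2 n x ∈ D := by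
    intro n x
    induction x using Completion.induction_on with
    | hp => exact hc.preimage (lp.isometry_single (p := 2) n).continuous
    | ih x => exact h1 n x
  refine Submodule.eq_top_iff'.2 fun x => ?_
  exact hc.mem_of_tendsto (lp.hasSum_single (by norm_num) x)
    (Filter.Eventually.of_forall fun s => D.sum_mem fun n _ => h2 n (x n))

/-- The vacuum is cyclic for the semicircular operators of a total family. -/
theorem dense_span_prod_vacuum (hf : (Submodule.span ℂ (Set.range f)).topologicalClosure = ⊤) :
    Dense (Submodule.span ℂ (Set.range fun w : List ι =>
      (w.map fun i => semicircular (f i)).prod (vacuum E)) : Set (Fock E)) := by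
  set D₀ := Submodule.span ℂ
    (Set.range fun w : List ι => (w.map fun i => leftCreation (f i)).prod (vacuum E)) with hD₀
  have hD : D₀.topologicalClosure = ⊤ := by
    refine eq_top_of_leftCreation_mem D₀.isClosed_topologicalClosure
      (D₀.le_topologicalClosure (Submodule.subset_span ⟨[], rfl⟩)) fun h x hx => ?_
    have hinv : ∀ i, ∀ y ∈ D₀.topologicalClosure, leftCreation (f i) y ∈ D₀.topologicalClosure := by
      intro i
      have hle : D₀ ≤ D₀.topologicalClosure.comap (leftCreation (f i)).toLinearMap := by
        refine Submodule.span_le.2 ?_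
        rintro _ ⟨w, rfl⟩
        exact D₀.le_topologicalClosure (Submodule.subset_span ⟨i :: w, rfl⟩)
      exact fun y hy => D₀.topologicalClosure_minimal hle
        (D₀.isClosed_topologicalClosure.preimage (leftCreation (f i)).continuous) hy
    -- For fixed `x`, `l(h) x` is linear and continuous in `h`, so invariance under the total family
    -- gives invariance under every `l(h)`.
    let L : E →L[ℂ] Fock E := leftCreationCLM.flip x
    have hle : Submodule.span ℂ (Set.range f) ≤ D₀.topologicalClosure.comap L.toLinearMap := by
      refine Submodule.span_le.2 ?_
      rintro _ ⟨i, rfl⟩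
      exact hinv i x hx
    have hcl := Submodule.topologicalClosure_minimal _ hle
      (D₀.isClosed_topologicalClosure.preimage L.continuous)
    rw [hf] at hcl
    exact hcl (Submodule.mem_top (x := h))
  rw [← Submodule.dense_iff_topologicalClosure_eq_top] at hD
  refine hD.mono (Submodule.span_le.2 ?_)
  rintro _ ⟨w, rfl⟩
  exact prod_leftCreation_vacuum_mem_span w

end Cyclic

end FreeFock

/-! ### The Wigner space -/

section Wigner

theorem halfLine_Icc_ne_top (t : ℝ≥0) : halfLine (Set.Icc (0 : ℝ) t) ≠ ∞ :=
  (Measure.restrict_apply_le _ _ |>.trans_lt measure_Icc_lt_top).ne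

/-- A square integrable function on the half line with vanishing primitive is zero. -/
theorem eq_zero_of_forall_setIntegral_Icc {𝕜 : Type*} [RCLike 𝕜] (f : Lp 𝕜 2 halfLine)
    (hf : ∀ t : ℝ≥0, ∫ x in Set.Icc (0 : ℝ) t, f x ∂halfLine = 0) : f = 0 := by
  have hF : MemLp ((Set.Ici (0 : ℝ)).indicator f) 2 volume :=
    (memLp_indicator_iff_restrict measurableSet_Ici).2 (Lp.memLp f)
  have hprim : ∀ t : ℝ, 0 ≤ t → ∫ x in (0 : ℝ)..t, (Set.Ici (0 : ℝ)).indicator f x = 0 := by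
    intro t ht
    have hsub : Set.Icc (0 : ℝ) t ⊆ Set.Ici 0 := fun x hx => hx.1
    have h : ∫ x in Set.Icc (0 : ℝ) t, f x ∂halfLine = 0 := hf ⟨t, ht⟩
    rw [Measure.restrict_restrict measurableSet_Icc, Set.inter_eq_left.2 hsub] at h
    rw [intervalIntegral.integral_of_le ht, ← integral_Icc_eq_integral_Ioc, ← h]
    exact setIntegral_congr_fun measurableSet_Icc fun x hx => Set.indicator_of_mem (hsub hx) _
  refine Lp.ext ?_
  refine Filter.EventuallyEq.trans ?_ (Lp.coeFn_zero 𝕜 2 halfLine).symm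
  rw [Filter.EventuallyEq, ae_restrict_iff' measurableSet_Ici]
  -- At `x > 0` the primitive vanishes on a whole neighbourhood, so Lebesgue differentiation gives
  -- the value `0`; the endpoint is discarded.
  have h0 : ∀ᵐ x : ℝ, x ≠ 0 := by simp [ae_iff, measure_singleton]
  filter_upwards [LocallyIntegrable.ae_hasDerivAt_integral
    (hF.locallyIntegrable (by norm_num)), h0] with x hx hx0 hxm
  have hpos : 0 < x := lt_of_le_of_ne hxm hx0.symm
  have hd : HasDerivAt (fun y => ∫ t in (0 : ℝ)..y, (Set.Ici (0 : ℝ)).indicator f t) 0 x :=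
    (hasDerivAt_const x (0 : 𝕜)).congr_of_eventuallyEq <| by
      filter_upwards [lt_mem_nhds hpos] with y hy
      exact hprim y hy.le
  have := (hx 0).unique hd
  rwa [Set.indicator_of_mem hxm] at this

/-- The indicator function `1_{[0,t]}` with values in `𝕜`. -/
noncomputable def indicatorIccLp (𝕜 : Type*) [RCLike 𝕜] (t : ℝ≥0) : Lp 𝕜 2 halfLine :=
  indicatorConstLp 2 (measurableSet_Icc (a := (0 : ℝ)) (b := (t : ℝ)))
    (halfLine_Icc_ne_top t) (1 : 𝕜)

/-- A vector orthogonal to all the indicators has vanishing primitive. The real case serves to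
identify the two algebras, the complex case to prove cyclicity. -/
theorem topologicalClosure_span_indicatorIccLp (𝕜 : Type*) [RCLike 𝕜] :
    (Submodule.span 𝕜 (Set.range (indicatorIccLp 𝕜))).topologicalClosure = ⊤ := by
  rw [Submodule.topologicalClosure_eq_top_iff, Submodule.eq_bot_iff]
  intro f hf
  refine eq_zero_of_forall_setIntegral_Icc f fun t => ?_
  have := (Submodule.mem_orthogonal _ _).1 hf _ (Submodule.subset_span ⟨t, rfl⟩)
  rwa [indicatorIccLp, L2.inner_indicatorConstLp_one] at this

theorem inner_indicatorIcc (s t : ℝ≥0) :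
    ⟪indicatorIcc s, indicatorIcc t⟫_ℂ = (((min s t : ℝ≥0) : ℝ) : ℂ) := by
  have hsub : Set.Icc (0 : ℝ) s ∩ Set.Icc 0 t ∩ Set.Ici 0 = Set.Icc 0 ((min s t : ℝ≥0) : ℝ) := by
    ext x
    simp only [Set.mem_inter_iff, Set.mem_Icc, Set.mem_Ici, NNReal.coe_min, le_min_iff]
    tauto
  rw [indicatorIcc, indicatorIcc,
    L2.inner_indicatorConstLp_indicatorConstLp (𝕜 := ℂ) measurableSet_Icc measurableSet_Icc
      (halfLine_Icc_ne_top s) (halfLine_Icc_ne_top t), measureReal_def,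
    Measure.restrict_apply (measurableSet_Icc.inter measurableSet_Icc), hsub, Real.volume_Icc,
    sub_zero, ENNReal.toReal_ofReal (NNReal.coe_nonneg _)]
  simp

theorem realToComplex_indicatorIccLp (t : ℝ≥0) :
    realToComplex (indicatorIccLp ℝ t) = indicatorIcc t := by
  refine Lp.ext ?_
  filter_upwards [ContinuousLinearMap.coeFn_compLp Complex.ofRealCLM (indicatorIccLp ℝ t),
    indicatorConstLp_coeFn (p := 2) (c := (1 : ℝ))
      (hs := measurableSet_Icc (a := (0 : ℝ)) (b := (t : ℝ)))
      (hμs := halfLine_Icc_ne_top t),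
    indicatorConstLp_coeFn (p := 2) (c := (1 : ℂ))
      (hs := measurableSet_Icc (a := (0 : ℝ)) (b := (t : ℝ)))
      (hμs := halfLine_Icc_ne_top t)] with x h0 h1 h2
  rw [realToComplex, h0, indicatorIccLp, indicatorIcc, h1, h2]
  by_cases hx : x ∈ Set.Icc (0 : ℝ) t <;> simp [hx]

theorem isClosed_generatedVN {H : Type u} [NormedAddCommGroup H] [InnerProductSpace ℂ H]
    [CompleteSpace H] (s : Set (H →L[ℂ] H)) : IsClosed (generatedVN s : Set (H →L[ℂ] H)) := by
  have e : (generatedVN s : Set (H →L[ℂ] H)) =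
      ⋂ y ∈ StarSubalgebra.centralizer ℂ s, {x | y * x = x * y} := by
    ext x
    simp only [Set.mem_iInter]
    exact mem_generatedVN_iff
  rw [e]
  exact isClosed_biInter fun y _ =>
    isClosed_eq (continuous_const.mul continuous_id) (continuous_id.mul continuous_const)

theorem semicircular_realToComplex_add (g h : Lp ℝ 2 halfLine) :
    FreeFock.semicircular (realToComplex (g + h)) =
      FreeFock.semicircular (realToComplex g) + FreeFock.semicircular (realToComplex h) := by
  rw [show realToComplex (g + h) = realToComplex g + realToComplex h from
    map_add (Complex.ofRealCLM.compLpL 2 halfLine) g h]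
  simp only [FreeFock.semicircular, FreeFock.leftAnnihilation, FreeFock.leftCreation_add, map_add]
  abel

/-- The scalar is real because `l*(h)` is conjugate-linear in `h`. -/
theorem semicircular_realToComplex_smul (c : ℝ) (h : Lp ℝ 2 halfLine) :
    FreeFock.semicircular (realToComplex (c • h)) =
      (c : ℂ) • FreeFock.semicircular (realToComplex h) := by
  have e : realToComplex (c • h) = (c : ℂ) • realToComplex h := by
    rw [Complex.coe_smul]
    exact map_smul (Complex.ofRealCLM.compLpL 2 halfLine) c h
  rw [e, FreeFock.semicircular, FreeFock.semicircular, FreeFock.leftAnnihilation,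
    FreeFock.leftCreation_smul, map_smulₛₗ, Complex.conj_ofReal, smul_add]
  rfl

theorem continuous_semicircular_realToComplex :
    Continuous fun h => FreeFock.semicircular (realToComplex h) := by
  have h1 : Continuous fun h => FreeFock.leftCreation (realToComplex h) :=
    FreeFock.leftCreationCLM.continuous.comp (Complex.ofRealCLM.compLpL 2 halfLine).continuous
  exact h1.add (ContinuousLinearMap.adjoint.continuous.comp h1)

/-- The real `h` with `S(h)` in the smaller algebra form a norm-closed real subspace containing the
total family of indicators. -/
theorem generatedVN_wignerBM :
    generatedVN (Set.range wignerBM) =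
      generatedVN (Set.range fun h => FreeFock.semicircular (realToComplex h)) := by
  refine VonNeumannAlgebra.ext fun x => ⟨fun hx => generatedVN_le ?_ hx, fun hx => generatedVN_le ?_ hx⟩
  · rintro _ ⟨t, rfl⟩
    refine adjoin_le_generatedVN _ (StarAlgebra.subset_adjoin ℂ _ ⟨indicatorIccLp ℝ t, ?_⟩)
    simp only [realToComplex_indicatorIccLp]
    rfl
  · rintro _ ⟨h, rfl⟩
    let N := generatedVN (Set.range wignerBM)
    let D : Submodule ℝ (Lp ℝ 2 halfLine) :=
      { carrier := {h | FreeFock.semicircular (realToComplex h) ∈ N}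
        add_mem' := fun {g h} hg hh => by
          rw [Set.mem_ofPred_eq, semicircular_realToComplex_add]
          exact add_mem hg hh
        zero_mem' := by
          rw [Set.mem_ofPred_eq, ← zero_smul ℝ (0 : Lp ℝ 2 halfLine),
            semicircular_realToComplex_smul, Complex.ofReal_zero, zero_smul]
          exact zero_mem N
        smul_mem' := fun c h hh => by
          rw [Set.mem_ofPred_eq, semicircular_realToComplex_smul]
          exact N.toStarSubalgebra.smul_mem hh _ }
    have hle : Submodule.span ℝ (Set.range (indicatorIccLp ℝ)) ≤ D := by
      refine Submodule.span_le.2 ?_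
      rintro _ ⟨t, rfl⟩
      change FreeFock.semicircular (realToComplex (indicatorIccLp ℝ t)) ∈ N
      rw [realToComplex_indicatorIccLp]
      exact adjoin_le_generatedVN _ (StarAlgebra.subset_adjoin ℂ _ ⟨t, rfl⟩)
    have hcl := Submodule.topologicalClosure_minimal _ hle
      ((isClosed_generatedVN _).preimage continuous_semicircular_realToComplex)
    rw [topologicalClosure_span_indicatorIccLp] at hcl
    exact hcl (Submodule.mem_top (x := h))

theorem isFactor_wignerBM : IsFactor (generatedVN (Set.range wignerBM)) :=
  isFactor_of_cyclic (Ω := FreeFock.vacuum L2C)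
    (fun _ => FreeFock.isSelfAdjoint_semicircular _)
    (fun w => FreeFock.inner_vacuum_prod_vacuum inner_indicatorIcc w)
    (FreeFock.dense_span_prod_vacuum (topologicalClosure_span_indicatorIccLp ℂ))

end Wigner

theorem mainTheorem4 :
    -- the free Brownian motion on the Wigner space (free Fock space over `L²(ℝ₊)`)
    (generatedVN (Set.range wignerBM) =
        generatedVN (Set.range fun h => FreeFock.semicircular (realToComplex h)) ∧
      IsFactor (generatedVN (Set.range wignerBM))) ∧
    -- any free Brownian motion in any von Neumann algebra with a faithful normal state
    (∀ (H : Type u) [NormedAddCommGroup H] [InnerProductSpace ℂ H] [CompleteSpace H]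
      (M : VonNeumannAlgebra H) (τ : M.toStarSubalgebra →ₗ[ℂ] ℂ) (S : ℝ≥0 → M.toStarSubalgebra),
      IsFaithfulNormalState M τ → IsFreeBrownianMotion M τ S →
        IsFactor (generatedVN (Set.range fun t => (S t : H →L[ℂ] H)))) :=
  ⟨⟨generatedVN_wignerBM, isFactor_wignerBM⟩, fun _ _ _ _ _ _ _ hτ hS => hS.isFactor hτ⟩
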